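/- **Setting.** Let $\mathcal S$ be a finite set, $(X,S,Y)\in\mathbb R^d\times\mathcal S\times\mathbb R$ with $|Y|\le A$ a.s. ($A>0$), $\pi_s=\mathbb P(S=s)\ge\pi_{\min}>0$ for all $s$, $\mathbb P_s=\mathbb P(\cdot\mid S=s)$, and $f^\star(x,s)=\mathbb E[Y\mid X=x,S=s]$. Fix $K\ge2$, $M\ge1$, levels $0<\ell_1<\dots<\ell_M<1$, thresholds $z_1<\dots<z_M$ in $[-A,A]$, and the grid $\mathcal Y_K=\{-A+\frac{2A}{K-1}(k-1):1\le k\le K\}$. Put $a(y)=(\mathbf 1\{y\le z_m\})_{m}$ and $\boldsymbol\ell=(\ell_m)_m$. For $\lambda\in\mathbb R^{\mathcal S\times M}$ and a predictor $f$ (possibly randomized, the probabilities below then including the randomization), let $$R(f)=\mathbb E[(Y-f(X,S))^2],\qquad \mathcal R_\lambda(f)=R(f)+\sum_{s,m}\lambda_{s,m}\big(\mathbb P_s(f(X,s)\le z_m)-\ell_m\big).$$ Let $f^\star_{\rm fair}$ be a minimizer of $R$ among the measurable $f:\mathbb R^d\times\mathcal S\to\mathcal Y_K$ with $\mathbb P_s(f(X,s)\le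 z_m)=\ell_m$ for all $s,m$, and let $\lambda^\star$ be a minimizer of $\lambda\mapsto\sum_s\mathbb E_s\big[\max_{y\in\mathcal Y_K}\{-\pi_s(y-f^\star(X,s))^2-\langle\lambda_s,a(y)-\boldsymbol\ell\rangle\}\big]$. **Procedure.** Let $\hat f$ be a base regressor (any measurable function for each value of $\mathcal D_n$) learned from a sample $\mathcal D_n$ of $n$ i.i.d. copies of $(X,S,Y)$. For $u\ge0$ let $\bar f(x,s)=\Pi_{[-A,A]}(\hat f(x,s)+\xi)$, where $\Pi_{[-A,A]}$ is the projection onto $[-A,A]$ and $\xi\sim\mathrm{Unif}([0,u])$ ($\xi=0$ if $u=0$) is drawn independently for each point at which $\bar f$ is evaluated. Let $\mathcal D_N=(X_i',S_i')_{i\le N}$, $N\ge1$, be i.i.d. copies of $(X,S)$, with i.i.d. dithering variables $\xi_i$ independent of them, the whole being independent of $\mathcal D_n$. Let $N_s=\#\{i:S'_i=s\}$, $\hat\pi_s=N_s/N$, let $\hat\lambda$ be any minimizer of $$\lambda\mapsto\sum_s\frac1{N_s}\sum_{i:S_i'=s}\max_{y\in\mathcal Y_K}\{-\hat\pi_s(y-\bar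 f(X_i',s))^2-\langle\lambda_s,a(y)-\boldsymbol\ell\rangle\}$$ (groups with $N_s=0$ contribute $0$), and let $\hat f_{\rm fair}$ be any measurable randomized predictor with $\hat f_{\rm fair}(x,s)\in\operatorname{argmin}_{y\in\mathcal Y_K}\{\hat\pi_s(y-\bar f(x,s))^2+\langle\hat\lambda_s,a(y)\rangle\}$. **Theorem.** There are constants $C_1,C_2$, depending only on $\mathcal S$, $\pi_{\min}$ and $A$, such that the following holds in every such setting. For almost every value of $\mathcal D_n$ for which $\hat f(X,S)-f^\star(X,S)$ is integrable and, for each $s$, the function $t\mapsto\mathbb P_s(\bar f(X,s)\le t)$ is continuous, and for every $\delta\in(0,1)$, with conditional probability at least $1-\delta$ given $\mathcal D_n$ (over $\mathcal D_N$ and the $\xi_i$), $$\mathcal R_{\lambda^\star}(\hat f_{\rm fair})-\mathcal R_{\lambda^\star}(f^\star_{\rm fair})\le C_1\Big(\mathbb E\big[|\hat f(X,S)-f^\star(X,S)|\,\big|\,\mathcal D_n\big]+\sqrt{\tfrac1N}+u\Big)+C_2M\Big(\sqrt{\tfrac1N}+\tfrac{K^2}N+\sqrt{\tfrac{\log(1/\delta)}N}\Big).$$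 -/

import Mathlib

open MeasureTheory ProbabilityTheory

namespace FairReg

noncomputable section

/-- The feature space `ℝ^d`. -/
abbrev Feat (d : ℕ) : Type := EuclideanSpace ℝ (Fin d)

/-- Space of labeled observations `(x, s, y)`. -/
abbrev Obs (d : ℕ) (S : Type*) : Type _ := Feat d × S × ℝ

/-- Space of calibration points `((x', s'), ξ)`: an unlabeled observation together with the
dithering variable that is drawn for it. -/
abbrev CalPt (d : ℕ) (S : Type*) : Type _ := (Feat d × S) × ℝ

/-- Predictors that may use the dithering variable: `f x s ξ`. -/
abbrev RandPred (d : ℕ) (S : Type*) : Type _ := Feat d → S → ℝ → ℝ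

/-- The uniform law on `[0, u]`, as the law of `u * U` with `U` uniform on `[0, 1]`
(the Dirac mass at `0` when `u = 0`). -/
def ditherLaw (u : ℝ) : Measure ℝ :=
  (volume.restrict (Set.Icc (0 : ℝ) 1)).map (fun t => u * t)

/-- A deterministic predictor, seen as one that ignores the dithering variable. -/
def detPred {d : ℕ} {S : Type*} (f : Feat d → S → ℝ) : RandPred d S := fun x s _ => f x s

/-- Measurability of a (randomized) predictor in all its variables jointly. -/
def MeasurablePred {d : ℕ} {S : Type*} [MeasurableSpace S] (f : RandPred d S) : Prop :=
  Measurable (fun v : (Feat d × S) × ℝ => f v.1.1 v.1.2 v.2)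

/-- The points `y_k = -A + 2 A k / (K - 1)`, `k = 0, …, K - 1`, of the regular grid. -/
def gridPt (A : ℝ) (K : ℕ) (k : Fin K) : ℝ := -A + 2 * A / ((K : ℝ) - 1) * (k : ℝ)

/-- `⟨c, a(y)⟩`, where `a(y) = (1{y ≤ z_1}, …, 1{y ≤ z_M})`. -/
def pairA {M : ℕ} (z c : Fin M → ℝ) (y : ℝ) : ℝ := ∑ m, c m * (if y ≤ z m then 1 else 0)

/-- `⟨c, a(y) - ℓ⟩`. -/
def pairB {M : ℕ} (z l c : Fin M → ℝ) (y : ℝ) : ℝ :=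
  ∑ m, c m * ((if y ≤ z m then 1 else 0) - l m)

section Population

variable {d : ℕ} {S : Type*} [MeasurableSpace S]

/-- `π_s = P(S = s)`, where `P` is the law of `(X, S, Y)`. -/
def groupWeight (P : Measure (Obs d S)) (s : S) : ℝ := P.real {w | w.2.1 = s}

/-- The conditional law of `(X, S, Y)` given `S = s`. -/
def groupLaw (P : Measure (Obs d S)) (s : S) : Measure (Obs d S) := P[|{w | w.2.1 = s}]

/-- `fStar` is a version of the regression function: `fStar(X, S) = E[Y | X, S]` a.s. -/
def IsBayes (P : Measure (Obs d S)) (fStar : Feat d → S → ℝ) : Prop :=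
  Measurable (fun v : Feat d × S => fStar v.1 v.2) ∧
    (fun w : Obs d S => fStar w.1 w.2.1) =ᵐ[P]
      P[fun w : Obs d S => w.2.2 |
        MeasurableSpace.comap (fun w : Obs d S => (w.1, w.2.1)) inferInstance]

/-- `R(f) = E[(Y - f(X, S, ξ))²]`, with `ξ` uniform on `[0, u]` independent of `(X, S, Y)`. -/
def risk (P : Measure (Obs d S)) (u : ℝ) (f : RandPred d S) : ℝ :=
  ∫ v, (v.1.2.2 - f v.1.1 v.1.2.1 v.2) ^ 2 ∂(P.prod (ditherLaw u))

/-- `P_s(f(X, s, ξ) ≤ t)`, with `ξ` uniform on `[0, u]` independent of `(X, S, Y)`. -/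
def groupCDF (P : Measure (Obs d S)) (u : ℝ) (f : RandPred d S) (s : S) (t : ℝ) : ℝ :=
  ((groupLaw P s).prod (ditherLaw u)).real {v | f v.1.1 s v.2 ≤ t}

/-- The Lagrangian-penalized risk `R_λ(f)`. -/
def penRisk [Fintype S] {M : ℕ} (P : Measure (Obs d S)) (u : ℝ) (z l : Fin M → ℝ)
    (lam : S → Fin M → ℝ) (f : RandPred d S) : ℝ :=
  risk P u f + ∑ s, ∑ m, lam s m * (groupCDF P u f s (z m) - l m)

/-- The deterministic measurable predictors with values in the grid that satisfy
`P_s(f(X, s) ≤ z_m) = ℓ_m` for all `s` and `m`. -/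
def fairClass {M : ℕ} (P : Measure (Obs d S)) (A : ℝ) (K : ℕ) (z l : Fin M → ℝ) :
    Set (Feat d → S → ℝ) :=
  {f | Measurable (fun v : Feat d × S => f v.1 v.2) ∧
    (∀ x s, f x s ∈ Set.range (gridPt A K)) ∧
    ∀ s m, groupCDF P 0 (detPred f) s (z m) = l m}

/-- `f` is a risk minimizer among the fair discretized predictors. -/
def IsOptimalFair {M : ℕ} (P : Measure (Obs d S)) (A : ℝ) (K : ℕ) (z l : Fin M → ℝ)
    (f : Feat d → S → ℝ) : Prop :=
  f ∈ fairClass P A K z l ∧ IsMinOn (fun g => risk P 0 (detPred g)) (fairClass P A K z l) f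

/-- The population dual objective
`∑_s E_s[max_k (-π_s (y_k - f⋆(X, s))² - ⟨λ_s, a(y_k) - ℓ⟩)]`. -/
def dualObj [Fintype S] {M : ℕ} (P : Measure (Obs d S)) (fStar : Feat d → S → ℝ) (A : ℝ) (K : ℕ)
    (z l : Fin M → ℝ) (lam : S → Fin M → ℝ) : ℝ :=
  ∑ s, ∫ w, (⨆ k : Fin K, (-(groupWeight P s * (gridPt A K k - fStar w.1 s) ^ 2)
    - pairB z l (lam s) (gridPt A K k))) ∂(groupLaw P s)

end Population

section Calibration

variable {d : ℕ} {S : Type*}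

/-- The dithered base regressor `Π_{[-A, A]}(f̂(x, s) + ξ)`. -/
def dithered (A : ℝ) (fHat : Feat d → S → ℝ) : RandPred d S :=
  fun x s ξ => max (-A) (min A (fHat x s + ξ))

/-- The law of one calibration point: `(X', S')` distributed as `(X, S)`, and an independent
dithering variable uniform on `[0, u]`. -/
def calLaw [MeasurableSpace S] (P : Measure (Obs d S)) (u : ℝ) : Measure (CalPt d S) :=
  (P.map (fun w => (w.1, w.2.1))).prod (ditherLaw u)

variable [DecidableEq S]

/-- `N_s`, the number of calibration points in group `s`. -/
def groupCount {N : ℕ} (D : Fin N → CalPt d S) (s : S) : ℕ :=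
  (Finset.univ.filter (fun i => (D i).1.2 = s)).card

/-- The empirical weight `N_s / N`. -/
def empWeight {N : ℕ} (D : Fin N → CalPt d S) (s : S) : ℝ := (groupCount D s : ℝ) / N

/-- The empirical dual objective
`∑_s (1 / N_s) ∑_{i : S'_i = s} max_k (-π̂_s (y_k - f̄(X'_i, s))² - ⟨λ_s, a(y_k) - ℓ⟩)`,
where `f̄(X'_i, s)` uses the dithering variable of the `i`-th calibration point; a group without
calibration points contributes `0`. -/
def empDualObj [Fintype S] {N M : ℕ} (fHat : Feat d → S → ℝ) (A : ℝ) (K : ℕ) (z l : Fin M → ℝ)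
    (D : Fin N → CalPt d S) (lam : S → Fin M → ℝ) : ℝ :=
  ∑ s, (groupCount D s : ℝ)⁻¹ * ∑ i with (D i).1.2 = s,
    ⨆ k : Fin K, (-(empWeight D s * (gridPt A K k - dithered A fHat (D i).1.1 s (D i).2) ^ 2)
      - pairB z l (lam s) (gridPt A K k))

/-- `g` is a post-processed predictor with multipliers `lam`: it is measurable, and
`g(x, s, ξ)` minimizes `π̂_s (y - f̄(x, s))² + ⟨λ_s, a(y)⟩` over the grid. -/
def IsPostProcessed [MeasurableSpace S] {N M : ℕ} (fHat : Feat d → S → ℝ) (A : ℝ) (K : ℕ)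
    (z : Fin M → ℝ) (D : Fin N → CalPt d S) (lam : S → Fin M → ℝ) (g : RandPred d S) : Prop :=
  MeasurablePred g ∧ ∀ x s ξ, g x s ξ ∈ Set.range (gridPt A K) ∧
    IsMinOn (fun y => empWeight D s * (y - dithered A fHat x s ξ) ^ 2 + pairA z (lam s) y)
      (Set.range (gridPt A K)) (g x s ξ)

end Calibration

end

end FairReg

/-! The argument compares primal and dual values. For any multipliers `λ`, the Bayes risk minus the
dual objective at `λ` bounds from below the penalized risk `R_λ` of every grid-valued predictor
(`neg_dualObj_le_penRisk`). Since `λ⋆` minimizes the dual, its dual value may be replaced by the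
larger one at `λ̂`. Hence the excess of the post-processed `g` is at most a sum over groups of the
means of `π_s (g - f⋆)² + ⟨λ⋆_s, a(g) - ℓ⟩` plus the maximized objective at `λ̂_s`
(`excess_le_gap`). Neither strong duality nor consistency of `λ̂` is needed.

Since `g` maximizes the grid objective built from `π̂_s` and the dithered `f̄`, it nearly maximizes
the one built from `π_s` and `f⋆`, up to `|π_s - π̂_s|` and `|f⋆ - f̄|` (`maxObj_le_of_isMinOn`).
The squares then cancel and leave the pairing of `λ⋆_s - λ̂_s` with the unfairness of `g`. Both
factors are controlled.

Multipliers: a fair predictor exists and the levels increase strictly, so each class cut out by the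
thresholds holds a grid point. A multiplier beyond `4 A² p` would price a whole class out of the
maximum, and the dual objective could be lowered (`abs_multiplier_le`). This applies to `λ⋆` and to
`λ̂`.

Unfairness: `g` crosses `z_m` at a single value `t` of `f̄` (`exists_threshold`), and first-order
optimality of `λ̂` makes `t` an empirical `ℓ_m`-quantile of `f̄` in the group
(`card_lt_threshold_le`). Continuity of the law of `f̄` removes ties, and a
Dvoretzky-Kiefer-Wolfowitz bound carries the statement to the population.

That bound does not depend on the number of thresholds: it follows from symmetrization and an
exponential potential for the maximum of a random walk. Independence of the two samples reduces
everything to a fixed base regressor. -/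

namespace FairReg
noncomputable section

/-! ### Exponential moments of the maximum of a signed walk -/

/-- The sign attached to `i` by a set `B`: `+1` on `B`, `-1` off `B`. -/
def signOf {ι : Type*} [DecidableEq ι] (B : Finset ι) (i : ι) : ℤ := if i ∈ B then 1 else -1

/-- The maximum of `0` and of the signed sums over the sets `{i ∈ I | V i ≤ t}`, `t ∈ T`. -/
def walkMax {ι α : Type*} [DecidableEq ι] [LinearOrder α] (V : ι → α) (T : Finset α)
    (I B : Finset ι) : ℤ :=
  T.fold max 0 (fun t => ∑ i ∈ I with V i ≤ t, signOf B i)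

lemma walkMax_nonneg {ι α : Type*} [DecidableEq ι] [LinearOrder α] (V : ι → α) (T : Finset α)
    (I B : Finset ι) : 0 ≤ walkMax V T I B :=
  (Finset.le_fold_max _).2 (Or.inl le_rfl)

lemma le_walkMax {ι α : Type*} [DecidableEq ι] [LinearOrder α] (V : ι → α) (T : Finset α)
    (I B : Finset ι) {t : α} (ht : t ∈ T) :
    ∑ i ∈ I with V i ≤ t, signOf B i ≤ walkMax V T I B :=
  (Finset.le_fold_max _).2 (Or.inr ⟨t, ht, le_rfl⟩)

/-- A point of smallest value is the first step of the walk: every nonempty partial sum gains its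
sign, and the empty ones contribute `0`. This is Lindley's recursion for the maximum. -/
lemma walkMax_insert_le {ι α : Type*} [DecidableEq ι] [LinearOrder α] (V : ι → α) (T : Finset α)
    (I B B' : Finset ι) (a : ι) (ha : a ∉ I) (hmin : ∀ x ∈ I, V a ≤ V x)
    (hB : ∀ i ∈ I, signOf B' i = signOf B i) :
    walkMax V T (insert a I) B' ≤ max 0 (signOf B' a + walkMax V T I B) := by
  refine (Finset.fold_max_le _).2 ⟨le_max_left _ _, fun t ht => ?_⟩
  have hsum : ∑ i ∈ I with V i ≤ t, signOf B' i = ∑ i ∈ I with V i ≤ t, signOf B i :=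
    Finset.sum_congr rfl fun i hi => hB i (Finset.mem_filter.1 hi).1
  rw [Finset.filter_insert]
  split_ifs with h
  · rw [Finset.sum_insert (by simp [ha]), hsum]
    have := le_walkMax V T I B ht
    exact le_max_of_le_right (by linarith)
  · have : Finset.filter (fun i => V i ≤ t) I = ∅ :=
      Finset.filter_eq_empty_iff.2 fun x hx hxt => h ((hmin x hx).trans hxt)
    simp [this]

/-- The potential that turns the running maximum of the walk into an exponential martingale. -/
def walkPot (c : ℝ) (m : ℤ) : ℝ := Real.exp (c * m) + Real.exp (-c * (m + 1))

/-- The potential is a multiple of `cosh (c (m + 1/2))`, which is even about `-1/2` and increases to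
the right of it. -/
lemma walkPot_mono {c : ℝ} (hc : 0 ≤ c) {m m' : ℤ} (hm : 0 ≤ m) (h : m ≤ m') :
    walkPot c m ≤ walkPot c m' := by
  have e : ∀ k : ℤ, walkPot c k = 2 * Real.exp (-c / 2) * Real.cosh (c * (k + 1 / 2)) := by
    intro k
    rw [walkPot, Real.cosh_eq]
    have h1 : c * (k : ℝ) = -c / 2 + c * (k + 1 / 2) := by ring
    have h2 : -c * ((k : ℝ) + 1) = -c / 2 + -(c * (k + 1 / 2)) := by ring
    rw [h1, h2, Real.exp_add, Real.exp_add]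
    ring_nf
  rw [e, e]
  have h0 : (0 : ℝ) ≤ m := by exact_mod_cast hm
  have h1 : (m : ℝ) ≤ m' := by exact_mod_cast h
  refine mul_le_mul_of_nonneg_left ?_ (by positivity)
  rw [Real.cosh_le_cosh, abs_of_nonneg (by positivity), abs_of_nonneg]
  · gcongr
  · have : (0 : ℝ) ≤ m' := h0.trans h1
    positivity

/-- The `cosh` is an eigenfunction of the two-point average. Its symmetry about `-1/2` gives `-1`
and `0` the same potential, so the reflection at `0` costs nothing. -/
lemma walkPot_step (c : ℝ) {m : ℤ} (hm : 0 ≤ m) :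
    walkPot c (max 0 (-1 + m)) + walkPot c (max 0 (1 + m)) = 2 * Real.cosh c * walkPot c m := by
  rw [max_eq_right (by omega : 0 ≤ 1 + m)]
  rcases hm.eq_or_lt with rfl | hm
  · simp only [walkPot, Real.cosh_eq]
    norm_num
    have h2 : Real.exp (-(c * 2)) = Real.exp (-c) * Real.exp (-c) := by
      rw [← Real.exp_add]; ring_nf
    have h3 : Real.exp c * Real.exp (-c) = 1 := by rw [← Real.exp_add]; simp
    rw [h2]
    linear_combination -h3
  · rw [max_eq_right (by omega)]
    simp only [walkPot, Real.cosh_eq]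
    push_cast
    have h1 : Real.exp (c * (-1 + (m : ℝ))) = Real.exp (-c) * Real.exp (c * m) := by
      rw [← Real.exp_add]; ring_nf
    have h2 : Real.exp (-c * (-1 + (m : ℝ) + 1)) = Real.exp c * Real.exp (-c * (m + 1)) := by
      rw [← Real.exp_add]; ring_nf
    have h3 : Real.exp (c * (1 + (m : ℝ))) = Real.exp c * Real.exp (c * m) := by
      rw [← Real.exp_add]; ring_nf
    have h4 : Real.exp (-c * (1 + (m : ℝ) + 1)) = Real.exp (-c) * Real.exp (-c * (m + 1)) := by
      rw [← Real.exp_add]; ring_nf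
    rw [h1, h2, h3, h4]
    ring

/-- Points are added in front of the walk, by decreasing `V`. The sets without and with the new
point give the steps `-1` and `+1`, so each point multiplies the sum by at most `2 cosh c`. -/
lemma sum_walkPot_le {ι α : Type*} [DecidableEq ι] [LinearOrder α] (V : ι → α) (T : Finset α)
    {c : ℝ} (hc : 0 ≤ c) (I : Finset ι) :
    ∑ B ∈ I.powerset, walkPot c (walkMax V T I B)
      ≤ (2 * Real.cosh c) ^ I.card * walkPot c 0 := by
  induction I using Finset.induction_on_min_value V with
  | empty =>
    have : ∀ s : Finset α, s.fold max (0 : ℤ) (fun _ => 0) = 0 := fun s =>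
      le_antisymm ((Finset.fold_max_le _).2 ⟨le_rfl, fun _ _ => le_rfl⟩)
        ((Finset.le_fold_max _).2 (Or.inl le_rfl))
    simp [walkMax, this]
  | insert a I ha hmin ih =>
    rw [Finset.sum_powerset_insert ha, ← Finset.sum_add_distrib, Finset.card_insert_of_notMem ha]
    calc _ ≤ ∑ B ∈ I.powerset, 2 * Real.cosh c * walkPot c (walkMax V T I B) := by
          refine Finset.sum_le_sum fun B hB => ?_
          have haB : a ∉ B := fun h => ha (Finset.mem_powerset.1 hB h)
          have h1 := walkMax_insert_le V T I B B a ha hmin fun _ _ => rfl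
          have h2 := walkMax_insert_le V T I B (insert a B) a ha hmin (by
            intro i hi
            have : i ≠ a := fun h => ha (h ▸ hi)
            simp [signOf, this])
          simp only [signOf, haB, if_false, Finset.mem_insert_self, if_true] at h1 h2
          rw [← walkPot_step c (walkMax_nonneg V T I B)]
          exact add_le_add (walkPot_mono hc (walkMax_nonneg _ _ _ _) h1)
            (walkPot_mono hc (walkMax_nonneg _ _ _ _) h2)
      _ ≤ 2 * Real.cosh c * ((2 * Real.cosh c) ^ I.card * walkPot c 0) := by
          rw [← Finset.mul_sum]
          exact mul_le_mul_of_nonneg_left ih (by positivity)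
      _ = _ := by ring

lemma sum_exp_walkMax_le {ι α : Type*} [DecidableEq ι] [Fintype ι] [LinearOrder α] (V : ι → α)
    (T : Finset α) {c : ℝ} (hc : 0 ≤ c) :
    ∑ B : Finset ι, Real.exp (c * walkMax V T Finset.univ B)
      ≤ 2 ^ Fintype.card ι * (2 * Real.exp (c ^ 2 / 2 * Fintype.card ι)) := by
  have h := sum_walkPot_le V T hc Finset.univ
  rw [Finset.powerset_univ, Finset.card_univ] at h
  calc _ ≤ ∑ B : Finset ι, walkPot c (walkMax V T Finset.univ B) :=
        Finset.sum_le_sum fun B _ => le_add_of_nonneg_right (Real.exp_pos _).le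
    _ ≤ _ := h
    _ ≤ 2 ^ Fintype.card ι * ((Real.exp (c ^ 2 / 2)) ^ Fintype.card ι * 2) := by
        rw [mul_pow, mul_assoc]
        have h1 : walkPot c 0 ≤ 2 := by
          have : Real.exp (-c) ≤ 1 := Real.exp_le_one_iff.2 (by linarith)
          simp only [walkPot]; norm_num; linarith
        have h2 : 0 ≤ walkPot c 0 := by unfold walkPot; positivity
        gcongr
        exact Real.cosh_le_exp_half_sq c
    _ = _ := by rw [← Real.exp_nat_mul]; ring_nf

/-! ### Maxima over finitely many thresholds, and Jensen's inequality -/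

/-- The maximum of `0` and of `|f t|`, `t ∈ T`. -/
def absMax {α : Type*} (T : Finset α) (f : α → ℝ) : ℝ := T.fold max 0 (fun t => |f t|)

lemma absMax_nonneg {α : Type*} (T : Finset α) (f : α → ℝ) : 0 ≤ absMax T f :=
  (Finset.le_fold_max _).2 (Or.inl le_rfl)

lemma le_absMax {α : Type*} {T : Finset α} (f : α → ℝ) {t : α} (ht : t ∈ T) :
    |f t| ≤ absMax T f :=
  (Finset.le_fold_max _).2 (Or.inr ⟨t, ht, le_rfl⟩)

lemma absMax_le {α : Type*} {T : Finset α} {f : α → ℝ} {C : ℝ} (hC : 0 ≤ C)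
    (h : ∀ t ∈ T, |f t| ≤ C) : absMax T f ≤ C :=
  (Finset.fold_max_le _).2 ⟨hC, h⟩

lemma measurable_absMax {α Y : Type*} [MeasurableSpace Y] (T : Finset α) {f : Y → α → ℝ}
    (hf : ∀ t, Measurable fun y => f y t) : Measurable fun y => absMax T (f y) := by
  classical
  induction T using Finset.induction_on with
  | empty => simp [absMax]
  | insert a T ha ih =>
    have : (fun y => absMax (insert a T) (f y)) = fun y => max |f y a| (absMax T (f y)) := by
      funext y; simp [absMax, Finset.fold_insert ha]
    rw [this]
    exact (hf a).abs.max ih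

lemma integrable_exp_absMax {α Y : Type*} [MeasurableSpace Y] {ν : Measure Y} [IsFiniteMeasure ν]
    (T : Finset α) {f : Y → α → ℝ} (hf : ∀ t, Measurable fun y => f y t) {C : ℝ}
    (hb : ∀ y t, |f y t| ≤ C) (hC : 0 ≤ C) {θ : ℝ} (hθ : 0 ≤ θ) :
    Integrable (fun y => Real.exp (θ * absMax T (f y))) ν := by
  refine Integrable.of_bound
    (Real.measurable_exp.comp ((measurable_absMax T hf).const_mul θ)).aestronglyMeasurable
    (Real.exp (θ * C)) (Filter.Eventually.of_forall fun y => ?_)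
  rw [Real.norm_eq_abs, Real.abs_exp]
  have := absMax_le (T := T) hC fun t _ => hb y t
  gcongr

lemma exp_abs_integral_le {Y : Type*} [MeasurableSpace Y] {ν : Measure Y} [IsProbabilityMeasure ν]
    {h : Y → ℝ} (hm : Measurable h) {C : ℝ} (hb : ∀ y, |h y| ≤ C) {θ : ℝ} (hθ : 0 ≤ θ) :
    Real.exp (θ * |∫ y, h y ∂ν|) ≤ ∫ y, Real.exp (θ * |h y|) ∂ν := by
  set a := θ * |∫ y, h y ∂ν| with ha
  have hi : Integrable h ν := Integrable.of_bound hm.aestronglyMeasurable C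
    (Filter.Eventually.of_forall hb)
  have hexp : Integrable (fun y => Real.exp (θ * |h y|)) ν := by
    refine Integrable.of_bound (by fun_prop) (Real.exp (θ * C))
      (Filter.Eventually.of_forall fun y => ?_)
    rw [Real.norm_eq_abs, Real.abs_exp]
    have := hb y
    gcongr
  have hle : a ≤ ∫ y, θ * |h y| ∂ν := by
    rw [integral_const_mul]
    exact mul_le_mul_of_nonneg_left abs_integral_le_integral_abs hθ
  have hlin : Integrable (fun y => θ * |h y| - a) ν := (hi.abs.const_mul θ).sub (integrable_const _)
  calc Real.exp a = Real.exp a * 1 := (mul_one _).symm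
    -- Jensen's inequality through the tangent line of the exponential at `a`.
    _ ≤ Real.exp a * ∫ y, ((θ * |h y| - a) + 1) ∂ν := by
        rw [integral_add hlin (integrable_const _), integral_sub (hi.abs.const_mul θ)
          (integrable_const _)]
        simp only [integral_const, probReal_univ, smul_eq_mul, one_mul]
        gcongr
        linarith
    _ = ∫ y, Real.exp a * ((θ * |h y| - a) + 1) ∂ν := (integral_const_mul _ _).symm
    _ ≤ ∫ y, Real.exp (θ * |h y|) ∂ν := by
        refine integral_mono ((hlin.add (integrable_const _)).const_mul _) hexp fun y => ?_
        have h1 := Real.add_one_le_exp (θ * |h y| - a)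
        have h2 : Real.exp (θ * |h y|) = Real.exp a * Real.exp (θ * |h y| - a) := by
          rw [← Real.exp_add]; ring_nf
        simp only [h2]
        gcongr

/-- The maximum over a finite set is `0` or is attained at one threshold, which reduces the claim to
a single function. -/
lemma exp_absMax_integral_le {α Y : Type*} [MeasurableSpace Y] {ν : Measure Y}
    [IsProbabilityMeasure ν] (T : Finset α) {f : Y → α → ℝ}
    (hf : ∀ t, Measurable fun y => f y t) {C : ℝ} (hC : 0 ≤ C)
    (hb : ∀ y t, |f y t| ≤ C) {θ : ℝ} (hθ : 0 ≤ θ) :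
    Real.exp (θ * absMax T (fun t => ∫ y, f y t ∂ν)) ≤ ∫ y, Real.exp (θ * absMax T (f y)) ∂ν := by
  have hint := integrable_exp_absMax (ν := ν) T hf hb hC hθ
  rcases (Finset.le_fold_max (f := fun t => |∫ y, f y t ∂ν|) (b := (0 : ℝ)) (s := T) _).1
    le_rfl with h | ⟨t, ht, h⟩
  · have h0 : absMax T (fun t => ∫ y, f y t ∂ν) = 0 := le_antisymm h (absMax_nonneg _ _)
    rw [h0, mul_zero, Real.exp_zero]
    have : ∫ _, (1 : ℝ) ∂ν ≤ ∫ y, Real.exp (θ * absMax T (f y)) ∂ν :=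
      integral_mono (integrable_const _) hint fun y =>
        Real.one_le_exp (mul_nonneg hθ (absMax_nonneg _ _))
    simpa using this
  · have h1 : absMax T (fun t => ∫ y, f y t ∂ν) ≤ |∫ y, f y t ∂ν| := h
    calc _ ≤ Real.exp (θ * |∫ y, f y t ∂ν|) := by gcongr
      _ ≤ ∫ y, Real.exp (θ * |f y t|) ∂ν := exp_abs_integral_le (hf t) (fun y => hb y t) hθ
      _ ≤ _ := by
        refine integral_mono ?_ hint fun y => ?_
        · refine Integrable.of_bound (by have := hf t; fun_prop) (Real.exp (θ * C))
            (Filter.Eventually.of_forall fun y => ?_)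
          rw [Real.norm_eq_abs, Real.abs_exp]
          have := hb y t
          gcongr
        · have := le_absMax (f y) ht
          simp only
          gcongr

/-- The indicator of `{V ≤ t}`. -/
def below {E α : Type*} [LinearOrder α] (V : E → α) (t : α) (e : E) : ℝ := if V e ≤ t then 1 else 0

lemma below_mem {E α : Type*} [LinearOrder α] (V : E → α) (t : α) (e : E) :
    0 ≤ below V t e ∧ below V t e ≤ 1 := by
  unfold below; split_ifs <;> norm_num

/-- Complementing `B` flips all the signs, so two one-sided maxima control the absolute value. -/
lemma abs_sum_signOf_below_le {ι E α : Type*} [DecidableEq ι] [Fintype ι] [LinearOrder α]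
    (V : E → α) (T : Finset α) (B : Finset ι) (x : ι → E) {t : α} (ht : t ∈ T) :
    |∑ i, (signOf B i : ℝ) * below V t (x i)|
      ≤ max (walkMax (V ∘ x) T Finset.univ B : ℝ) (walkMax (V ∘ x) T Finset.univ Bᶜ) := by
  have e : ∀ B : Finset ι, ∑ i, (signOf B i : ℝ) * below V t (x i)
      = ((∑ i with (V ∘ x) i ≤ t, signOf B i : ℤ) : ℝ) := by
    intro B
    push_cast
    rw [Finset.sum_filter]
    refine Finset.sum_congr rfl fun i _ => ?_
    simp [below]
  have hc : ∀ i, (signOf Bᶜ i : ℝ) = -signOf B i := by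
    intro i; by_cases h : i ∈ B <;> simp [signOf, h]
  have h1 : ∑ i, (signOf B i : ℝ) * below V t (x i) ≤ walkMax (V ∘ x) T Finset.univ B := by
    rw [e]; exact_mod_cast le_walkMax (V ∘ x) T Finset.univ B ht
  have h2 : -∑ i, (signOf B i : ℝ) * below V t (x i) ≤ walkMax (V ∘ x) T Finset.univ Bᶜ := by
    have : -∑ i, (signOf B i : ℝ) * below V t (x i)
        = ∑ i, (signOf Bᶜ i : ℝ) * below V t (x i) := by
      rw [← Finset.sum_neg_distrib]
      exact Finset.sum_congr rfl fun i _ => by rw [hc]; ring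
    rw [this, e]; exact_mod_cast le_walkMax (V ∘ x) T Finset.univ Bᶜ ht
  exact abs_le'.2 ⟨le_max_of_le_left h1, le_max_of_le_right h2⟩

lemma exp_half_sum_max_le (θ a b c d : ℝ) :
    Real.exp (θ * (max a b + max c d)) ≤ (Real.exp (2 * θ * a) + Real.exp (2 * θ * b)
      + Real.exp (2 * θ * c) + Real.exp (2 * θ * d)) / 2 := by
  have key : ∀ p q : ℝ, Real.exp (2 * θ * max p q)
      ≤ Real.exp (2 * θ * p) + Real.exp (2 * θ * q) := by
    intro p q
    rcases max_choice p q with h | h <;> rw [h]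
    · linarith [Real.exp_pos (2 * θ * q)]
    · linarith [Real.exp_pos (2 * θ * p)]
  have h1 : Real.exp (θ * (max a b + max c d))
      ≤ (Real.exp (2 * θ * max a b) + Real.exp (2 * θ * max c d)) / 2 := by
    have e1 : Real.exp (2 * θ * max a b) = Real.exp (θ * max a b) ^ 2 := by
      rw [← Real.exp_nat_mul]; push_cast; ring_nf
    have e2 : Real.exp (2 * θ * max c d) = Real.exp (θ * max c d) ^ 2 := by
      rw [← Real.exp_nat_mul]; push_cast; ring_nf
    rw [e1, e2, mul_add, Real.exp_add]
    nlinarith [sq_nonneg (Real.exp (θ * max a b) - Real.exp (θ * max c d))]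
  linarith [key a b, key c d]

/-- The two samples are separated by the triangle inequality, and each becomes a walk ordered by its
own values of `V`. The product of the two exponentials is split by `2ab ≤ a² + b²`, which doubles
`θ`. The size of `T` never enters. -/
lemma sum_exp_absMax_signed_le {ι E α : Type*} [DecidableEq ι] [Fintype ι] [LinearOrder α]
    (V : E → α) (T : Finset α) (x y : ι → E) {θ : ℝ} (hθ : 0 ≤ θ) :
    ∑ B : Finset ι, Real.exp (θ * absMax T fun t =>
        ∑ i, (signOf B i : ℝ) * (below V t (x i) - below V t (y i)))
      ≤ 2 ^ Fintype.card ι * (4 * Real.exp (2 * θ ^ 2 * Fintype.card ι)) := by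
  set w : (ι → E) → Finset ι → ℝ := fun x B => Real.exp (2 * θ * walkMax (V ∘ x) T Finset.univ B)
    with hw
  have hw1 : ∀ x : ι → E, ∑ B, w x B
      ≤ 2 ^ Fintype.card ι * (2 * Real.exp (2 * θ ^ 2 * Fintype.card ι)) := by
    intro x
    have := sum_exp_walkMax_le (V ∘ x) T (c := 2 * θ) (by positivity)
    have e : (2 * θ) ^ 2 / 2 * (Fintype.card ι : ℝ) = 2 * θ ^ 2 * Fintype.card ι := by ring
    rwa [e] at this
  have hw2 : ∀ x : ι → E, ∑ B, w x Bᶜ = ∑ B, w x B := fun x =>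
    Equiv.sum_comp (compl_involutive.toPerm (compl : Finset ι → Finset ι)) (w x)
  calc _ ≤ ∑ B : Finset ι, (w x B + w x Bᶜ + w y B + w y Bᶜ) / 2 := by
        refine Finset.sum_le_sum fun B _ => ?_
        refine le_trans ?_ (exp_half_sum_max_le θ _ _ _ _)
        gcongr
        refine absMax_le (add_nonneg (le_max_of_le_left ?_) (le_max_of_le_left ?_)) fun t ht => ?_
        · exact_mod_cast walkMax_nonneg _ _ _ _
        · exact_mod_cast walkMax_nonneg _ _ _ _
        · simp only [mul_sub, Finset.sum_sub_distrib]
          exact (abs_sub _ _).trans (add_le_add (abs_sum_signOf_below_le V T B x ht)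
            (abs_sum_signOf_below_le V T B y ht))
    _ = ∑ B, w x B + ∑ B, w y B := by
        rw [← Finset.sum_div, Finset.sum_add_distrib, Finset.sum_add_distrib,
          Finset.sum_add_distrib, hw2, hw2]
        ring
    _ ≤ _ := by linarith [hw1 x, hw1 y]

/-! ### Symmetrization and the Dvoretzky-Kiefer-Wolfowitz inequality -/

section Deviation

variable {ι E α : Type*} [Fintype ι] [MeasurableSpace E] [LinearOrder α]

lemma measurable_below {V : E → α} (hV : ∀ t, MeasurableSet {e | V e ≤ t}) (t : α) :
    Measurable (below V t) :=
  Measurable.ite (hV t) measurable_const measurable_const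

lemma integral_below (P : Measure E) {V : E → α} (hV : ∀ t, MeasurableSet {e | V e ≤ t}) (t : α) :
    ∫ e, below V t e ∂P = P.real {e | V e ≤ t} := by
  have : below V t = Set.indicator {e | V e ≤ t} 1 := by
    funext e; simp [below, Set.indicator_apply]
  rw [this, integral_indicator_one (hV t)]

lemma abs_sum_le_card {f : ι → ℝ} (h : ∀ i, |f i| ≤ 1) : |∑ i, f i| ≤ Fintype.card ι :=
  (Finset.abs_sum_le_sum_abs _ _).trans
    ((Finset.sum_le_sum fun i _ => h i).trans (by simp))

lemma integral_exp_absMax_pair_le [DecidableEq ι] (P : Measure E) [IsProbabilityMeasure P]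
    {V : E → α} (hV : ∀ t, MeasurableSet {e | V e ≤ t}) (T : Finset α) {θ : ℝ} (hθ : 0 ≤ θ) :
    ∫ p : ι → E × E, Real.exp (θ * absMax T fun t => ∑ i, (below V t (p i).1 - below V t (p i).2))
        ∂(Measure.pi fun _ => P.prod P)
      ≤ 4 * Real.exp (2 * θ ^ 2 * Fintype.card ι) := by
  set Q : Measure (ι → E × E) := Measure.pi fun _ => P.prod P with hQ
  set G : Finset ι → (ι → E × E) → ℝ := fun B p => Real.exp (θ * absMax T fun t =>
    ∑ i, (signOf B i : ℝ) * (below V t (p i).1 - below V t (p i).2)) with hG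
  have hm : ∀ (B : Finset ι) t, Measurable fun p : ι → E × E =>
      ∑ i, (signOf B i : ℝ) * (below V t (p i).1 - below V t (p i).2) := by
    intro B t
    have := measurable_below hV t
    fun_prop
  have hint : ∀ B, Integrable (G B) Q := fun B => by
    refine integrable_exp_absMax T (hm B) (C := Fintype.card ι) (fun p t => ?_) (by positivity) hθ
    refine abs_sum_le_card fun i => ?_
    have h1 := below_mem V t (p i).1
    have h2 := below_mem V t (p i).2
    have h3 : |(signOf B i : ℝ)| = 1 := by unfold signOf; split_ifs <;> simp
    rw [abs_mul, h3, one_mul, abs_le]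
    constructor <;> linarith
  -- Exchanging the two copies at the indices outside `B` preserves the product law and flips
  -- exactly those signs. The integral thus equals its average over all `B`.
  have hswap : ∀ B, ∫ p, G B p ∂Q = ∫ p, G Finset.univ p ∂Q := by
    intro B
    have hmp : MeasurePreserving
        (fun (p : ι → E × E) i => (if i ∈ B then id else Prod.swap) (p i)) Q Q := by
      refine measurePreserving_pi _ _ (f := fun i => if i ∈ B then id else Prod.swap) fun i => ?_
      split_ifs
      · exact MeasurePreserving.id _
      · exact Measure.measurePreserving_swap
    have hmap := integral_map (f := G Finset.univ) (μ := Q) hmp.measurable.aemeasurable (by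
      rw [hmp.map_eq]; exact (hint Finset.univ).aestronglyMeasurable)
    rw [hmp.map_eq] at hmap
    rw [hmap]
    refine integral_congr_ae (Filter.Eventually.of_forall fun p => ?_)
    simp only [hG]
    congr 3
    funext t
    refine Finset.sum_congr rfl fun i _ => ?_
    by_cases h : i ∈ B <;> simp [signOf, h]
  have hid : ∀ p : ι → E × E, Real.exp (θ * absMax T fun t =>
      ∑ i, (below V t (p i).1 - below V t (p i).2)) = G Finset.univ p := by
    intro p; simp [hG, signOf]
  simp only [hid]
  have hsum : (2 : ℝ) ^ Fintype.card ι * ∫ p, G Finset.univ p ∂Q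
      ≤ 2 ^ Fintype.card ι * (4 * Real.exp (2 * θ ^ 2 * Fintype.card ι)) := by
    calc _ = ∑ B : Finset ι, ∫ p, G B p ∂Q := by simp [hswap]
      _ = ∫ p, ∑ B : Finset ι, G B p ∂Q := (integral_finsetSum _ fun B _ => hint B).symm
      _ ≤ ∫ _, 2 ^ Fintype.card ι * (4 * Real.exp (2 * θ ^ 2 * Fintype.card ι)) ∂Q :=
        integral_mono (integrable_finsetSum _ fun B _ => hint B) (integrable_const _) fun p =>
          sum_exp_absMax_signed_le V T (fun i => (p i).1) (fun i => (p i).2) hθ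
      _ = _ := by simp
  exact le_of_mul_le_mul_left hsum (by positivity)

/-- The mean is the integral over an independent ghost sample, and Jensen's inequality moves that
integral outside the exponential. -/
lemma integral_exp_absMax_centered_le (P : Measure E) [IsProbabilityMeasure P]
    {V : E → α} (hV : ∀ t, MeasurableSet {e | V e ≤ t}) (T : Finset α) {θ : ℝ} (hθ : 0 ≤ θ) :
    ∫ x : ι → E, Real.exp (θ * absMax T fun t => ∑ i, (below V t (x i) - P.real {e | V e ≤ t}))
        ∂(Measure.pi fun _ => P)
      ≤ 4 * Real.exp (2 * θ ^ 2 * Fintype.card ι) := by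
  classical
  refine le_trans ?_ (integral_exp_absMax_pair_le (ι := ι) P hV T hθ)
  set Q : Measure (ι → E) := Measure.pi fun _ => P with hQ
  set f : (ι → E) → (ι → E) → α → ℝ := fun x y t => ∑ i, (below V t (x i) - below V t (y i)) with hf
  have hm : ∀ t, Measurable fun q : (ι → E) × (ι → E) => f q.1 q.2 t := by
    intro t
    have := measurable_below hV t
    simp only [hf]
    fun_prop
  have hfb : ∀ x y t, |f x y t| ≤ Fintype.card ι := by
    intro x y t
    refine abs_sum_le_card fun i => ?_
    have h1 := below_mem V t (x i)
    have h2 := below_mem V t (y i)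
    rw [abs_le]
    constructor <;> linarith
  have hI : ∀ x t, ∫ y, f x y t ∂Q = ∑ i, (below V t (x i) - P.real {e | V e ≤ t}) := by
    intro x t
    have hbi : ∀ i : ι, Integrable (fun y : ι → E => below V t (y i)) Q := fun i =>
      Integrable.of_bound
        ((measurable_below hV t).comp (measurable_pi_apply i)).aestronglyMeasurable 1
        (Filter.Eventually.of_forall fun y => by
          have := below_mem V t (y i)
          rw [Real.norm_eq_abs, abs_le]; constructor <;> linarith)
    simp only [hf]
    rw [integral_finsetSum (f := fun i (y : ι → E) => below V t (x i) - below V t (y i)) _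
      fun i _ => (integrable_const _).sub (hbi i)]
    refine Finset.sum_congr rfl fun i _ => ?_
    rw [integral_sub (integrable_const _) (hbi i), hQ]
    have hev := measurePreserving_eval (fun _ : ι => P) i
    have hmap := integral_map (f := below V t) (μ := Measure.pi fun _ : ι => P)
      hev.measurable.aemeasurable
      (measurable_below hV t).aestronglyMeasurable
    rw [hev.map_eq, integral_below P hV] at hmap
    rw [hmap]
    simp
  have hmp := measurePreserving_arrowProdEquivProdArrow E E ι (fun _ => P) (fun _ => P)
  have hpair : ∫ p : ι → E × E, Real.exp (θ * absMax T fun t =>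
        ∑ i, (below V t (p i).1 - below V t (p i).2)) ∂(Measure.pi fun _ => P.prod P)
      = ∫ q, Real.exp (θ * absMax T (f q.1 q.2)) ∂(Q.prod Q) :=
    hmp.integral_comp' (fun q => Real.exp (θ * absMax T (f q.1 q.2)))
  have hint : Integrable (fun q : (ι → E) × (ι → E) => Real.exp (θ * absMax T (f q.1 q.2)))
      (Q.prod Q) :=
    integrable_exp_absMax T hm (fun q t => hfb _ _ t) (by positivity) hθ
  rw [hpair, integral_prod _ hint]
  refine integral_mono ?_ hint.integral_prod_left fun x => ?_
  · refine integrable_exp_absMax T (C := Fintype.card ι) (fun t => ?_) (fun x t => ?_)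
      (by positivity) hθ
    · have := measurable_below hV t
      fun_prop
    · refine abs_sum_le_card fun i => ?_
      have h1 := below_mem V t (x i)
      have h2 : P.real {e | V e ≤ t} ≤ 1 := measureReal_le_one
      have h3 : 0 ≤ P.real {e | V e ≤ t} := measureReal_nonneg
      rw [abs_le]
      constructor <;> linarith
  · simp only [← hI]
    exact exp_absMax_integral_le T (fun t => (hm t).comp measurable_prodMk_left) (by positivity)
      (fun y t => hfb x y t) hθ

/-- A Dvoretzky-Kiefer-Wolfowitz inequality over finitely many thresholds. -/
lemma measure_exists_abs_sum_ge_le (P : Measure E) [IsProbabilityMeasure P]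
    {V : E → α} (hV : ∀ t, MeasurableSet {e | V e ≤ t}) (T : Finset α) {η : ℝ} (hη : 0 ≤ η) :
    (Measure.pi fun _ : ι => P) {x | ∃ t ∈ T, η * Fintype.card ι
        ≤ |∑ i, (below V t (x i) - P.real {e | V e ≤ t})|}
      ≤ ENNReal.ofReal (4 * Real.exp (-(Fintype.card ι * η ^ 2 / 8))) := by
  set Q : Measure (ι → E) := Measure.pi fun _ => P with hQ
  set Z : (ι → E) → ℝ := fun x => absMax T fun t => ∑ i, (below V t (x i) - P.real {e | V e ≤ t})
    with hZ
  set n : ℝ := ((Fintype.card ι : ℕ) : ℝ) with hn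
  have hsub : {x : ι → E | ∃ t ∈ T, η * n ≤ |∑ i, (below V t (x i) - P.real {e | V e ≤ t})|}
      ⊆ {x | Real.exp (η / 4 * (η * n)) ≤ Real.exp (η / 4 * Z x)} := by
    rintro x ⟨t, ht, h⟩
    have h1 := h.trans (le_absMax (fun t => ∑ i, (below V t (x i) - P.real {e | V e ≤ t})) ht)
    simp only [Set.mem_ofPred_eq]
    gcongr
  have hint : Integrable (fun x => Real.exp (η / 4 * Z x)) Q := by
    refine integrable_exp_absMax T (C := Fintype.card ι) (fun t => ?_) (fun x t => ?_)
      (by positivity) (by positivity)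
    · have := measurable_below hV t
      fun_prop
    · refine abs_sum_le_card fun i => ?_
      have h1 := below_mem V t (x i)
      have h2 : P.real {e | V e ≤ t} ≤ 1 := measureReal_le_one
      have h3 : 0 ≤ P.real {e | V e ≤ t} := measureReal_nonneg
      rw [abs_le]
      constructor <;> linarith
  have hmk := mul_meas_ge_le_integral_of_nonneg
    (Filter.Eventually.of_forall fun x => (Real.exp_pos (η / 4 * Z x)).le) hint
    (Real.exp (η / 4 * (η * n)))
  -- `θ = η / 4` minimizes the Chernoff exponent `2 θ² n - θ η n`, with value `-n η² / 8`.
  have hE := integral_exp_absMax_centered_le (ι := ι) P hV T (θ := η / 4) (by positivity)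
  refine (measure_mono hsub).trans ?_
  rw [← ofReal_measureReal]
  refine ENNReal.ofReal_le_ofReal ?_
  have h3 := hmk.trans hE
  have hpos := Real.exp_pos (η / 4 * (η * n))
  rw [mul_comm, ← le_div_iff₀ hpos] at h3
  refine h3.trans (le_of_eq ?_)
  rw [mul_div_assoc, ← Real.exp_sub]
  congr 2
  ring

/-- A Dvoretzky-Kiefer-Wolfowitz inequality over countably many thresholds. -/
lemma measure_exists_abs_sum_ge_le_of_countable (P : Measure E) [IsProbabilityMeasure P]
    {V : E → α} (hV : ∀ t, MeasurableSet {e | V e ≤ t}) {T : Set α} (hT : T.Countable)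
    {η : ℝ} (hη : 0 ≤ η) :
    (Measure.pi fun _ : ι => P) {x | ∃ t ∈ T, η * Fintype.card ι
        ≤ |∑ i, (below V t (x i) - P.real {e | V e ≤ t})|}
      ≤ ENNReal.ofReal (4 * Real.exp (-(Fintype.card ι * η ^ 2 / 8))) := by
  classical
  rcases T.eq_empty_or_nonempty with rfl | hne
  · simp
  obtain ⟨φ, rfl⟩ := hT.exists_eq_range hne
  -- The finite bound is uniform in the number of thresholds, so it passes to the increasing union.
  set A : ℕ → Set (ι → E) := fun n => {x | ∃ t ∈ (Finset.range n).image φ, η * Fintype.card ι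
        ≤ |∑ i, (below V t (x i) - P.real {e | V e ≤ t})|} with hA
  have hU : {x : ι → E | ∃ t ∈ Set.range φ, η * Fintype.card ι
        ≤ |∑ i, (below V t (x i) - P.real {e | V e ≤ t})|} = ⋃ n, A n := by
    ext x
    simp only [hA, Set.mem_ofPred_eq, Set.mem_iUnion, Finset.mem_image, Finset.mem_range]
    constructor
    · rintro ⟨_, ⟨k, rfl⟩, h⟩
      exact ⟨k + 1, φ k, ⟨k, by omega, rfl⟩, h⟩
    · rintro ⟨_, _, ⟨k, _, rfl⟩, h⟩
      exact ⟨φ k, ⟨k, rfl⟩, h⟩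
  have hmono : Monotone A := by
    rintro m n hmn x ⟨t, ht, h⟩
    exact ⟨t, Finset.image_subset_image (Finset.range_subset_range.2 hmn) ht, h⟩
  rw [hU, hmono.measure_iUnion]
  exact iSup_le fun n => measure_exists_abs_sum_ge_le P hV _ hη

end Deviation

/-! ### The grid objective and the size of optimal multipliers -/

/-- The value `-p (y_k - v)² - ⟨c, a(y_k) - ℓ⟩` of the `k`-th grid point. -/
def gridObj {M : ℕ} (A : ℝ) (K : ℕ) (z l : Fin M → ℝ) (p v : ℝ) (c : Fin M → ℝ) (k : Fin K) : ℝ :=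
  -(p * (gridPt A K k - v) ^ 2) - pairB z l c (gridPt A K k)

/-- The largest value over the grid. -/
def maxObj {M : ℕ} (A : ℝ) (K : ℕ) (z l : Fin M → ℝ) (p v : ℝ) (c : Fin M → ℝ) : ℝ :=
  ⨆ k : Fin K, gridObj A K z l p v c k

section MaxObj

variable {M K : ℕ} {A : ℝ} {z l : Fin M → ℝ}

lemma gridObj_le_maxObj (p v : ℝ) (c : Fin M → ℝ) (k : Fin K) :
    gridObj A K z l p v c k ≤ maxObj A K z l p v c :=
  le_ciSup (f := gridObj A K z l p v c) (Set.finite_range _).bddAbove k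

lemma maxObj_le [NeZero K] {p v : ℝ} {c : Fin M → ℝ} {C : ℝ}
    (h : ∀ k, gridObj A K z l p v c k ≤ C) : maxObj A K z l p v c ≤ C :=
  ciSup_le h

lemma exists_gridObj_eq_maxObj [NeZero K] (p v : ℝ) (c : Fin M → ℝ) :
    ∃ k, gridObj A K z l p v c k = maxObj A K z l p v c :=
  exists_eq_ciSup_of_finite

lemma gridPt_mem (hA : 0 ≤ A) (hK : 2 ≤ K) (k : Fin K) : |gridPt A K k| ≤ A := by
  have h1 : (0 : ℝ) < (K : ℝ) - 1 := by
    have : (2 : ℝ) ≤ K := by exact_mod_cast hK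
    linarith
  have h2 : ((k : ℕ) : ℝ) ≤ (K : ℝ) - 1 := by
    have : ((k : ℕ) : ℝ) + 1 ≤ K := by exact_mod_cast k.2
    linarith
  have h3 : 2 * A / ((K : ℝ) - 1) * (k : ℕ) ≤ 2 * A := by
    rw [div_mul_eq_mul_div, div_le_iff₀ h1]
    gcongr
  have h4 : 0 ≤ 2 * A / ((K : ℝ) - 1) * (k : ℕ) := by positivity
  unfold gridPt
  rw [abs_le]
  constructor <;> linarith

lemma sq_sub_le_of_abs_le {A a b : ℝ} (ha : |a| ≤ A) (hb : |b| ≤ A) : (a - b) ^ 2 ≤ 4 * A ^ 2 := by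
  have h1 := abs_le.1 ha
  have h2 := abs_le.1 hb
  nlinarith

lemma pairB_add_smul (c e : Fin M → ℝ) (ε y : ℝ) :
    pairB z l (c + ε • e) y = pairB z l c y + ε * pairB z l e y := by
  simp only [pairB, Pi.add_apply, Pi.smul_apply, smul_eq_mul, Finset.mul_sum,
    ← Finset.sum_add_distrib]
  exact Finset.sum_congr rfl fun m _ => by ring

lemma pairB_sub (c e : Fin M → ℝ) (y : ℝ) :
    pairB z l (c - e) y = pairB z l c y - pairB z l e y := by
  simp only [pairB, Pi.sub_apply, ← Finset.sum_sub_distrib]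
  exact Finset.sum_congr rfl fun m _ => by ring

lemma pairB_single (m : Fin M) (y : ℝ) :
    pairB z l (Pi.single m 1) y = (if y ≤ z m then 1 else 0) - l m := by
  unfold pairB
  rw [Finset.sum_eq_single m]
  · simp
  · intro b _ hb; simp [hb]
  · simp

lemma pairB_eq_pairA_sub (c : Fin M → ℝ) (y : ℝ) :
    pairB z l c y = pairA z c y - ∑ m, c m * l m := by
  simp only [pairB, pairA, ← Finset.sum_sub_distrib]
  exact Finset.sum_congr rfl fun m _ => by ring

lemma abs_pairB_le {c : Fin M → ℝ} {C : ℝ} (hc : ∀ m, |c m| ≤ C)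
    (hl : ∀ m, l m ∈ Set.Ioo (0 : ℝ) 1) (y : ℝ) : |pairB z l c y| ≤ M * C := by
  refine (Finset.abs_sum_le_sum_abs _ _).trans ?_
  calc _ ≤ ∑ _m : Fin M, C := by
        refine Finset.sum_le_sum fun m _ => ?_
        rw [abs_mul]
        have h1 : |(if y ≤ z m then (1 : ℝ) else 0) - l m| ≤ 1 := by
          have := hl m
          rw [abs_le]
          split_ifs <;> constructor <;> linarith [this.1, this.2]
        have h2 := hc m
        have h3 := abs_nonneg (c m)
        nlinarith
    _ = _ := by simp

lemma gridObj_add_smul (p v : ℝ) (c e : Fin M → ℝ) (ε : ℝ) (k : Fin K) :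
    gridObj A K z l p v (c + ε • e) k
      = gridObj A K z l p v c k - ε * pairB z l e (gridPt A K k) := by
  unfold gridObj; rw [pairB_add_smul]; ring

/-- Lowering the price of a class of grid points that is dominated by another grid point
decreases the objective. -/
lemma maxObj_add_smul_le [NeZero K] (hA : 0 ≤ A) (hK : 2 ≤ K) {p v : ℝ} (hp : 0 ≤ p)
    (hv : |v| ≤ A) {c e : Fin M → ℝ} {ε b : ℝ} (J : Fin K → Prop)
    [DecidablePred J] (he : ∀ k, pairB z l e (gridPt A K k) = b - if J k then 1 else 0)
    (j : Fin K) (hj : ∀ k, J k → pairB z l c (gridPt A K j) + 4 * A ^ 2 * p + ε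
      ≤ pairB z l c (gridPt A K k)) :
    maxObj A K z l p v (c + ε • e) ≤ maxObj A K z l p v c - ε * b := by
  refine maxObj_le fun k => ?_
  rw [gridObj_add_smul, he]
  split_ifs with h
  · have h1 := hj k h
    have h2 := gridObj_le_maxObj (A := A) (z := z) (l := l) p v c j
    have h3 := sq_sub_le_of_abs_le (gridPt_mem hA hK j) hv
    have h4 : p * (gridPt A K j - v) ^ 2 ≤ p * (4 * A ^ 2) := by gcongr
    have h5 : 0 ≤ p * (gridPt A K k - v) ^ 2 := by positivity
    unfold gridObj at h2 ⊢
    nlinarith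
  · have := gridObj_le_maxObj (A := A) (z := z) (l := l) p v c k
    linarith

/-- Multipliers that cannot be improved uniformly are bounded, as soon as each of the classes cut
out by the thresholds holds a grid point. -/
lemma abs_multiplier_le [NeZero K] (hA : 0 ≤ A) (hK : 2 ≤ K) {p : ℝ} (hp : 0 ≤ p)
    (hl : ∀ m, l m ∈ Set.Ioo (0 : ℝ) 1) (hlm : StrictMono l) (hzm : StrictMono z)
    (hlow : ∀ m, ∃ k, gridPt A K k ≤ z m ∧ ∀ m' < m, z m' < gridPt A K k)
    (hupp : ∀ m, ∃ k, z m < gridPt A K k ∧ ∀ m' > m, gridPt A K k ≤ z m')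
    {c : Fin M → ℝ}
    (hmin : ∀ (e : Fin M → ℝ) (ε b : ℝ), 0 < ε → 0 < b →
      ¬ ∀ v, |v| ≤ A → maxObj A K z l p v (c + ε • e) ≤ maxObj A K z l p v c - ε * b)
    (m : Fin M) : |c m| ≤ 4 * A ^ 2 * p := by
  classical
  -- Two points in the adjacent classes on either side of `z m` differ only in the `m`-th indicator.
  have hjump : ∀ y y', y ≤ z m → (∀ m' < m, z m' < y) → z m < y' → (∀ m' > m, y' ≤ z m') →
      pairB z l c y = pairB z l c y' + c m := by
    intro y y' h1 h2 h3 h4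
    rw [← sub_eq_iff_eq_add', pairB, pairB, ← Finset.sum_sub_distrib,
      Finset.sum_eq_single m]
    · simp [h1, not_le.2 h3]; ring
    · intro m' _ hne
      rcases lt_or_gt_of_ne hne with h | h
      · have h5 := h2 m' h
        have h6 : z m' < y' := (hzm h).trans h3
        simp [not_le.2 h5, not_le.2 h6]
      · have h5 : y ≤ z m' := h1.trans (hzm h).le
        simp [h5, h4 m' h]
    · simp
  rw [abs_le]
  constructor
  · by_contra hcon
    push Not at hcon
    obtain ⟨j, hj1, hj2⟩ := hlow m
    set J : Fin K → Prop := fun k => z m < gridPt A K k ∧ ∀ m' > m, gridPt A K k ≤ z m' with hJ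
    -- The direction `e` pays only the class `J` just above `z m`, and `b` is the increment of level
    -- over that class, with `1` playing the role of the level after the last.
    obtain ⟨e, b, hb, he⟩ : ∃ (e : Fin M → ℝ) (b : ℝ), 0 < b ∧
        ∀ k, pairB z l e (gridPt A K k) = b - if J k then 1 else 0 := by
      by_cases hlast : (m : ℕ) + 1 < M
      · set m₁ : Fin M := ⟨m + 1, hlast⟩ with hm₁
        have hlt : m < m₁ := Fin.lt_def.2 (by simp [hm₁])
        refine ⟨Pi.single m 1 - Pi.single m₁ 1, l m₁ - l m, sub_pos.2 (hlm hlt), fun k => ?_⟩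
        rw [pairB_sub, pairB_single, pairB_single]
        have hJk : J k ↔ z m < gridPt A K k ∧ gridPt A K k ≤ z m₁ :=
          ⟨fun h => ⟨h.1, h.2 _ hlt⟩, fun h => ⟨h.1, fun m' hm' => h.2.trans
            (hzm.monotone (Fin.le_def.2 (by simp only [hm₁]; exact hm')))⟩⟩
        have hz := hzm hlt
        by_cases h1 : gridPt A K k ≤ z m
        · simp [hJk, h1, not_lt.2 h1, h1.trans hz.le]
        · by_cases h2 : gridPt A K k ≤ z m₁
          · simp [hJk, h1, not_le.1 h1, h2]; ring
          · simp [hJk, h1, h2]; ring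
      · refine ⟨Pi.single m 1, 1 - l m, sub_pos.2 (hl m).2, fun k => ?_⟩
        rw [pairB_single]
        have hJk : J k ↔ ¬ gridPt A K k ≤ z m :=
          ⟨fun h => not_le.2 h.1, fun h => ⟨not_le.1 h, fun m' hm' =>
            absurd (Fin.lt_def.1 hm') (by have := m'.2; omega)⟩⟩
        by_cases h1 : gridPt A K k ≤ z m <;> simp [hJk, h1]
    -- The step is the whole excess of `-c m` over `4 A² p`. A price gap of `4 A² p` outweighs any
    -- difference of squared losses, so `J` stays dominated and the maximum falls by the step times
    -- `b`.
    refine hmin e (-c m - 4 * A ^ 2 * p) b (by linarith) hb fun v hv =>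
      maxObj_add_smul_le hA hK hp hv J he j fun k hk => ?_
    linarith [hjump _ _ hj1 hj2 hk.1 hk.2]
  · by_contra hcon
    push Not at hcon
    obtain ⟨j, hj1, hj2⟩ := hupp m
    set J : Fin K → Prop := fun k => gridPt A K k ≤ z m ∧ ∀ m' < m, z m' < gridPt A K k with hJ
    -- Mirror image for the class just below `z m`, with `0` as the level before the first.
    obtain ⟨e, b, hb, he⟩ : ∃ (e : Fin M → ℝ) (b : ℝ), 0 < b ∧
        ∀ k, pairB z l e (gridPt A K k) = b - if J k then 1 else 0 := by
      by_cases hfirst : 0 < (m : ℕ)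
      · set m₁ : Fin M := ⟨m - 1, by omega⟩ with hm₁
        have hlt : m₁ < m := Fin.lt_def.2 (by simp only [hm₁]; omega)
        refine ⟨Pi.single m₁ 1 - Pi.single m 1, l m - l m₁, sub_pos.2 (hlm hlt), fun k => ?_⟩
        rw [pairB_sub, pairB_single, pairB_single]
        have hJk : J k ↔ gridPt A K k ≤ z m ∧ z m₁ < gridPt A K k :=
          ⟨fun h => ⟨h.1, h.2 _ hlt⟩, fun h => ⟨h.1, fun m' hm' => lt_of_le_of_lt
            (hzm.monotone (Fin.le_def.2 (by
              simp only [hm₁]; have := Fin.lt_def.1 hm'; omega))) h.2⟩⟩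
        have hz := hzm hlt
        by_cases h1 : gridPt A K k ≤ z m₁
        · simp [hJk, h1, not_lt.2 h1, h1.trans hz.le]
        · by_cases h2 : gridPt A K k ≤ z m
          · simp [hJk, h1, not_le.1 h1, h2]; ring
          · simp [hJk, h1, h2]; ring
      · refine ⟨-Pi.single m 1, l m, (hl m).1, fun k => ?_⟩
        have : pairB z l (-Pi.single m 1) (gridPt A K k)
            = -pairB z l (Pi.single m 1) (gridPt A K k) := by
          simp [pairB]
        rw [this, pairB_single]
        have hJk : J k ↔ gridPt A K k ≤ z m :=
          ⟨fun h => h.1, fun h => ⟨h, fun m' hm' =>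
            absurd (Fin.lt_def.1 hm') (by omega)⟩⟩
        by_cases h1 : gridPt A K k ≤ z m <;> simp [hJk, h1]
    refine hmin e (c m - 4 * A ^ 2 * p) b (by linarith) hb fun v hv =>
      maxObj_add_smul_le hA hK hp hv J he j fun k hk => ?_
    linarith [hjump _ _ hk.1 hk.2 hj1 hj2]

end MaxObj

/-! ### Threshold structure and empirical first-order optimality -/

/-- Penalized nearest points are monotone in the target, hence cross a level at one threshold. -/
lemma exists_threshold {A p : ℝ} (hp : 0 < p) (φ : ℝ → ℝ) (Y : Set ℝ) (a : ℝ) :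
    ∃ t : ℝ, ∀ v, |v| ≤ A → ∀ y ∈ Y, IsMinOn (fun y => p * (y - v) ^ 2 + φ y) Y y →
      (v < t → y ≤ a) ∧ (t < v → a < y) := by
  have hmono : ∀ v v' y y', v < v' → y ∈ Y → y' ∈ Y →
      IsMinOn (fun y => p * (y - v) ^ 2 + φ y) Y y →
      IsMinOn (fun y => p * (y - v') ^ 2 + φ y) Y y' → y ≤ y' := by
    intro v v' y y' hv hy hy' h h'
    have h1 := isMinOn_iff.1 h y' hy'
    have h2 := isMinOn_iff.1 h' y hy
    by_contra hcon
    push Not at hcon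
    -- Adding the two optimality inequalities cancels `φ` and leaves a cross term of the opposite
    -- sign.
    have h3 : 0 < p * ((v' - v) * (y - y')) :=
      mul_pos hp (mul_pos (sub_pos.2 hv) (sub_pos.2 hcon))
    nlinarith
  -- Inserting `-A` keeps `L` nonempty. It is harmless, since no admissible `v` lies below `-A`.
  set L : Set ℝ := insert (-A) {v | |v| ≤ A ∧ ∃ y ∈ Y,
    IsMinOn (fun y => p * (y - v) ^ 2 + φ y) Y y ∧ y ≤ a} with hL
  have hbdd : BddAbove L := by
    refine ⟨max (-A) A, ?_⟩
    rintro v (rfl | hv)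
    · exact le_max_left _ _
    · exact le_max_of_le_right (abs_le.1 hv.1).2
  refine ⟨sSup L, fun v hv y hy hmin => ⟨fun hlt => ?_, fun hlt => ?_⟩⟩
  · obtain ⟨v', hv', hvv'⟩ := exists_lt_of_lt_csSup ⟨-A, Set.mem_insert _ _⟩ hlt
    rcases hv' with rfl | ⟨_, y', hy', hmin', hya⟩
    · exact absurd (abs_le.1 hv).1 (not_le.2 hvv')
    · exact (hmono v v' y y' hvv' hy hy' hmin hmin').trans hya
  · by_contra hcon
    exact absurd (le_csSup hbdd (Set.mem_insert_of_mem _ ⟨hv, y, hy, hmin, not_lt.1 hcon⟩))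
      (not_le.2 hlt)

section Empirical

variable {M K : ℕ} {A : ℝ} {z l : Fin M → ℝ}

lemma isMinOn_of_gridObj_eq_maxObj {p v : ℝ} {c : Fin M → ℝ} {k : Fin K}
    (h : gridObj A K z l p v c k = maxObj A K z l p v c) :
    IsMinOn (fun y => p * (y - v) ^ 2 + pairA z c y) (Set.range (gridPt A K)) (gridPt A K k) := by
  rw [isMinOn_iff]
  rintro _ ⟨k', rfl⟩
  have := gridObj_le_maxObj (A := A) (z := z) (l := l) p v c k'
  rw [← h] at this
  unfold gridObj at this
  rw [pairB_eq_pairA_sub, pairB_eq_pairA_sub] at this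
  linarith

/-- First-order optimality of the multipliers, across a threshold. -/
lemma card_lt_threshold_le [NeZero K] {ι : Type*} (I : Finset ι) (v : ι → ℝ) {p : ℝ}
    {c : Fin M → ℝ} (hmin : ∀ c' : Fin M → ℝ,
      ∑ i ∈ I, maxObj A K z l p (v i) c ≤ ∑ i ∈ I, maxObj A K z l p (v i) c')
    (m : Fin M) {t : ℝ}
    (ht : ∀ i ∈ I, ∀ y ∈ Set.range (gridPt A K),
      IsMinOn (fun y => p * (y - v i) ^ 2 + pairA z c y) (Set.range (gridPt A K)) y →
      (v i < t → y ≤ z m) ∧ (t < v i → z m < y)) :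
    ((I.filter fun i => v i < t).card : ℝ) ≤ I.card * l m ∧
      I.card * l m ≤ ((I.filter fun i => v i ≤ t).card : ℝ) := by
  -- There are finitely many values, so one gap separates all suboptimal ones from their maximum. A
  -- perturbation of that size can be tested directly, without subdifferentials.
  obtain ⟨ε, hε, hgap⟩ : ∃ ε > 0, ∀ i ∈ I, ∀ k : Fin K,
      gridObj A K z l p (v i) c k < maxObj A K z l p (v i) c →
      gridObj A K z l p (v i) c k + ε ≤ maxObj A K z l p (v i) c := by
    have : ∀ᶠ ε in nhdsWithin (0 : ℝ) (Set.Ioi 0), ∀ i ∈ I, ∀ k : Fin K,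
        gridObj A K z l p (v i) c k < maxObj A K z l p (v i) c →
        gridObj A K z l p (v i) c k + ε ≤ maxObj A K z l p (v i) c := by
      rw [Filter.eventually_all_finset]
      intro i _
      rw [Filter.eventually_all]
      intro k
      by_cases h : gridObj A K z l p (v i) c k < maxObj A K z l p (v i) c
      · have h0 : 0 < maxObj A K z l p (v i) c - gridObj A K z l p (v i) c k := sub_pos.2 h
        filter_upwards [Ioo_mem_nhdsGT h0] with ε hε _
        linarith [hε.2]
      · exact Filter.Eventually.of_forall fun ε h' => absurd h' h
    obtain ⟨ε, h1, h2⟩ := (this.and self_mem_nhdsWithin).exists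
    exact ⟨ε, h2, h1⟩
  constructor
  -- When `v i < t` all maximizers lie below `z m` and pay `ε (1 - l m)`; otherwise the maximum
  -- rises by at most `ε l m`. Points with `v i = t` may behave either way, hence the strict count
  -- here and the weak one in the other half.
  · have hpt : ∀ i ∈ I, maxObj A K z l p (v i) (c + ε • Pi.single m 1)
        ≤ maxObj A K z l p (v i) c + ε * (l m - if v i < t then 1 else 0) := by
      intro i hi
      refine maxObj_le fun k => ?_
      rw [gridObj_add_smul, pairB_single]
      have hle := gridObj_le_maxObj (A := A) (z := z) (l := l) p (v i) c k
      by_cases hk : gridPt A K k ≤ z m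
      · rw [if_pos hk]
        split_ifs <;> linarith
      · rw [if_neg hk]
        split_ifs with hvt
        · have hne : gridObj A K z l p (v i) c k ≠ maxObj A K z l p (v i) c := fun h =>
            hk ((ht i hi _ ⟨k, rfl⟩ (isMinOn_of_gridObj_eq_maxObj h)).1 hvt)
          linarith [hgap i hi k (lt_of_le_of_ne hle hne)]
        · linarith
    have h1 := (hmin (c + ε • Pi.single m 1)).trans (Finset.sum_le_sum hpt)
    rw [Finset.sum_add_distrib, ← Finset.mul_sum, Finset.sum_sub_distrib, Finset.sum_const,
      Finset.sum_boole, nsmul_eq_mul] at h1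
    have h2 : 0 ≤ ε * (I.card * l m - ((I.filter fun i => v i < t).card : ℝ)) := by linarith
    linarith [nonneg_of_mul_nonneg_right h2 hε]
  · have hpt : ∀ i ∈ I, maxObj A K z l p (v i) (c + (-ε) • Pi.single m 1)
        ≤ maxObj A K z l p (v i) c + ε * ((if v i ≤ t then 1 else 0) - l m) := by
      intro i hi
      refine maxObj_le fun k => ?_
      rw [gridObj_add_smul, pairB_single]
      have hle := gridObj_le_maxObj (A := A) (z := z) (l := l) p (v i) c k
      by_cases hk : gridPt A K k ≤ z m
      · rw [if_pos hk]
        split_ifs with hvt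
        · linarith
        · have hne : gridObj A K z l p (v i) c k ≠ maxObj A K z l p (v i) c := fun h =>
            absurd hk (not_le.2 ((ht i hi _ ⟨k, rfl⟩
              (isMinOn_of_gridObj_eq_maxObj h)).2 (not_le.1 hvt)))
          linarith [hgap i hi k (lt_of_le_of_ne hle hne)]
      · rw [if_neg hk]
        split_ifs <;> linarith
    have h1 := (hmin (c + (-ε) • Pi.single m 1)).trans (Finset.sum_le_sum hpt)
    rw [Finset.sum_add_distrib, ← Finset.mul_sum, Finset.sum_sub_distrib, Finset.sum_const,
      Finset.sum_boole, nsmul_eq_mul] at h1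
    have h2 : 0 ≤ ε * (((I.filter fun i => v i ≤ t).card : ℝ) - I.card * l m) := by linarith
    linarith [nonneg_of_mul_nonneg_right h2 hε]

end Empirical

/-! ### The dithering law and the conditional laws of the groups -/

instance isProbabilityMeasure_ditherLaw (u : ℝ) : IsProbabilityMeasure (ditherLaw u) := by
  have : IsProbabilityMeasure (volume.restrict (Set.Icc (0 : ℝ) 1)) :=
    ⟨by simp⟩
  exact Measure.isProbabilityMeasure_map (by fun_prop)

lemma ae_ditherLaw_mem {u : ℝ} (hu : 0 ≤ u) : ∀ᵐ ξ ∂(ditherLaw u), 0 ≤ ξ ∧ ξ ≤ u := by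
  rw [ditherLaw, ae_map_iff (by fun_prop) (by measurability)]
  filter_upwards [ae_restrict_mem measurableSet_Icc] with t ht
  exact ⟨mul_nonneg hu ht.1, mul_le_of_le_one_right hu ht.2⟩

section Group

variable {d : ℕ} {S : Type*} [MeasurableSpace S] [MeasurableSingletonClass S]
  {P : Measure (Obs d S)} [IsProbabilityMeasure P]

lemma measurableSet_group (s : S) : MeasurableSet {w : Obs d S | w.2.1 = s} :=
  measurableSet_preimage (measurable_fst.comp measurable_snd) (measurableSet_singleton s)

lemma measurableSet_group_prod (s : S) : MeasurableSet {v : Obs d S × ℝ | v.1.2.1 = s} :=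
  measurable_fst (measurableSet_group s)

omit [MeasurableSingletonClass S] [IsProbabilityMeasure P] in
lemma measure_group_ne_zero {s : S} (hs : 0 < groupWeight P s) : P {w | w.2.1 = s} ≠ 0 := by
  intro h
  simp [groupWeight, measureReal_def, h] at hs

omit [MeasurableSingletonClass S] in
lemma isProbabilityMeasure_groupLaw {s : S} (hs : 0 < groupWeight P s) :
    IsProbabilityMeasure (groupLaw P s) :=
  cond_isProbabilityMeasure (measure_group_ne_zero hs)

omit [MeasurableSingletonClass S] in
lemma groupLaw_prod (ν : Measure ℝ) [IsProbabilityMeasure ν] (s : S) :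
    (groupLaw P s).prod ν
      = (P {w | w.2.1 = s})⁻¹ • (P.prod ν).restrict {v | v.1.2.1 = s} := by
  have h1 : {v : Obs d S × ℝ | v.1.2.1 = s} = {w | w.2.1 = s} ×ˢ Set.univ := by
    ext v; simp
  rw [groupLaw, ProbabilityTheory.cond, Measure.prod_smul_left, h1, ← Measure.prod_restrict,
    Measure.restrict_univ]

omit [MeasurableSingletonClass S] in
lemma groupWeight_mul_integral (ν : Measure ℝ) [IsProbabilityMeasure ν] {s : S}
    (hs : 0 < groupWeight P s) (f : Obs d S × ℝ → ℝ) :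
    groupWeight P s * ∫ v, f v ∂((groupLaw P s).prod ν)
      = ∫ v in {v | v.1.2.1 = s}, f v ∂(P.prod ν) := by
  rw [groupLaw_prod, integral_smul_measure, ENNReal.toReal_inv, smul_eq_mul, ← mul_assoc]
  change groupWeight P s * (groupWeight P s)⁻¹ * _ = _
  rw [mul_inv_cancel₀ hs.ne', one_mul]

/-- The law of total expectation over the groups. -/
lemma integral_eq_sum_groups [Fintype S] (ν : Measure ℝ) [IsProbabilityMeasure ν]
    (hs : ∀ s, 0 < groupWeight P s) (q : S → Obs d S × ℝ → ℝ)
    (hq : Integrable (fun v => q v.1.2.1 v) (P.prod ν)) :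
    ∫ v, q v.1.2.1 v ∂(P.prod ν)
      = ∑ s, groupWeight P s * ∫ v, q s v ∂((groupLaw P s).prod ν) := by
  have hU : (⋃ s : S, {v : Obs d S × ℝ | v.1.2.1 = s}) = Set.univ := by ext v; simp
  rw [← setIntegral_univ, ← hU, integral_iUnion_fintype measurableSet_group_prod]
  · refine Finset.sum_congr rfl fun s _ => ?_
    rw [groupWeight_mul_integral ν (hs s)]
    exact setIntegral_congr_fun (measurableSet_group_prod s) fun v hv => by
      have : v.1.2.1 = s := hv
      simp only [this]
  · intro s t hst
    exact Set.disjoint_left.2 fun v hv hv' => hst (hv.symm.trans hv')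
  · exact fun s => hq.integrableOn

omit [MeasurableSingletonClass S] in
lemma groupLaw_prod_absolutelyContinuous (ν : Measure ℝ) [IsProbabilityMeasure ν] (s : S) :
    (groupLaw P s).prod ν ≪ P.prod ν := by
  rw [groupLaw_prod]
  exact (Measure.smul_absolutelyContinuous).trans Measure.restrict_le_self.absolutelyContinuous

lemma ae_groupLaw_prod_mem (ν : Measure ℝ) [IsProbabilityMeasure ν] (s : S) :
    ∀ᵐ v ∂((groupLaw P s).prod ν), v.1.2.1 = s := by
  rw [groupLaw_prod]
  exact Measure.smul_absolutelyContinuous.ae_le (ae_restrict_mem (measurableSet_group_prod s))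

omit [MeasurableSingletonClass S] in
lemma real_groupLaw_prod (ν : Measure ℝ) [IsProbabilityMeasure ν] {s : S}
    (hs : 0 < groupWeight P s) {B : Set (Obs d S × ℝ)} (hB : MeasurableSet B) :
    groupWeight P s * ((groupLaw P s).prod ν).real B
      = (P.prod ν).real (B ∩ {v | v.1.2.1 = s}) := by
  rw [← integral_indicator_one hB, groupWeight_mul_integral ν hs, integral_indicator_one hB,
    measureReal_restrict_apply hB]

end Group

/-! ### Orthogonality of the regression function -/

section Bayes

variable {d : ℕ} {S : Type*} [MeasurableSpace S] {P : Measure (Obs d S)} [IsProbabilityMeasure P]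
  {A : ℝ} {fStar : Feat d → S → ℝ}

lemma comap_features_le : MeasurableSpace.comap (fun w : Obs d S => (w.1, w.2.1)) inferInstance
    ≤ (inferInstance : MeasurableSpace (Obs d S)) :=
  Measurable.comap_le (by fun_prop)

lemma integrable_response (hY : ∀ᵐ w ∂P, |w.2.2| ≤ A) :
    Integrable (fun w : Obs d S => w.2.2) P :=
  Integrable.of_bound
    (by fun_prop : Measurable fun w : Obs d S => w.2.2).aestronglyMeasurable A hY

omit [IsProbabilityMeasure P] in
lemma IsBayes.measurable (hf : IsBayes P fStar) :
    Measurable (fun w : Obs d S => fStar w.1 w.2.1) :=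
  hf.1.comp (g := fun v : Feat d × S => fStar v.1 v.2)
    (by fun_prop : Measurable fun w : Obs d S => (w.1, w.2.1))

omit [IsProbabilityMeasure P] in
lemma IsBayes.ae_abs_le (hY : ∀ᵐ w ∂P, |w.2.2| ≤ A) (hf : IsBayes P fStar) :
    ∀ᵐ w ∂P, |fStar w.1 w.2.1| ≤ A := by
  have h := ae_bdd_abs_condExp_of_ae_bdd_abs (R := A)
    (m := MeasurableSpace.comap (fun w : Obs d S => (w.1, w.2.1)) inferInstance)
    (f := fun w : Obs d S => w.2.2) (μ := P) hY
  filter_upwards [h, hf.2] with w h1 h2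
  rw [h2]
  exact h1

lemma IsBayes.integral_mul_eq_zero (hY : ∀ᵐ w ∂P, |w.2.2| ≤ A)
    (hf : IsBayes P fStar) {k : Feat d → S → ℝ} (hk : Measurable fun v : Feat d × S => k v.1 v.2)
    {C : ℝ} (hkb : ∀ᵐ w ∂P, |k w.1 w.2.1| ≤ C) :
    ∫ w, (w.2.2 - fStar w.1 w.2.1) * k w.1 w.2.1 ∂P = 0 := by
  have hle := comap_features_le (d := d) (S := S)
  have hkm : Measurable[MeasurableSpace.comap (fun w : Obs d S => (w.1, w.2.1)) inferInstance]
      fun w : Obs d S => k w.1 w.2.1 :=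
    hk.comp (g := fun v : Feat d × S => k v.1 v.2) (comap_measurable _)
  have hki : Measurable fun w : Obs d S => k w.1 w.2.1 := hkm.mono hle le_rfl
  have hint : Integrable (fun w : Obs d S => w.2.2) P := integrable_response hY
  have hfi : Integrable (fun w : Obs d S => fStar w.1 w.2.1) P :=
    Integrable.of_bound hf.measurable.aestronglyMeasurable A (hf.ae_abs_le hY)
  have h1 : Integrable (fun w : Obs d S => w.2.2 * k w.1 w.2.1) P :=
    hint.mul_bdd (c := C) hki.aestronglyMeasurable hkb
  have h2 : Integrable (fun w : Obs d S => fStar w.1 w.2.1 * k w.1 w.2.1) P :=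
    hfi.mul_bdd (c := C) hki.aestronglyMeasurable hkb
  have hpull := condExp_mul_of_stronglyMeasurable_right (μ := P)
    (m := MeasurableSpace.comap (fun w : Obs d S => (w.1, w.2.1)) inferInstance)
    (f := fun w : Obs d S => w.2.2) (g := fun w : Obs d S => k w.1 w.2.1)
    hkm.stronglyMeasurable h1 hint
  have h3 : ∫ w, w.2.2 * k w.1 w.2.1 ∂P = ∫ w, fStar w.1 w.2.1 * k w.1 w.2.1 ∂P := by
    rw [← integral_condExp hle]
    refine integral_congr_ae ?_
    filter_upwards [hpull, hf.2] with w hw1 hw2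
    rw [hw2]
    exact hw1
  simp only [sub_mul]
  rw [integral_sub h1 h2, h3, sub_self]

end Bayes

lemma measurable_pairB {M : ℕ} (z l c : Fin M → ℝ) : Measurable (pairB z l c) := by
  unfold pairB
  refine Finset.measurable_sum _ fun m _ => Measurable.const_mul ?_ _
  exact (Measurable.ite measurableSet_Iic measurable_const measurable_const).sub measurable_const

lemma measurable_maxObj {M : ℕ} (A : ℝ) (K : ℕ) (z l : Fin M → ℝ) (p : ℝ) (c : Fin M → ℝ) :
    Measurable fun v => maxObj A K z l p v c := by
  refine Measurable.iSup fun k => ?_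
  unfold gridObj
  fun_prop

lemma abs_multiplier_le_sum {M : ℕ} (c : Fin M → ℝ) (m : Fin M) : |c m| ≤ ∑ m, |c m| :=
  Finset.single_le_sum (f := fun m => |c m|) (fun _ _ => abs_nonneg _) (Finset.mem_univ m)

lemma abs_maxObj_le {M K : ℕ} [NeZero K] {A : ℝ} {z l : Fin M → ℝ} (hA : 0 ≤ A) (hK : 2 ≤ K)
    (hl : ∀ m, l m ∈ Set.Ioo (0 : ℝ) 1) {p v : ℝ} (hp : 0 ≤ p) (hv : |v| ≤ A) {c : Fin M → ℝ}
    {C : ℝ} (hc : ∀ m, |c m| ≤ C) :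
    |maxObj A K z l p v c| ≤ 4 * A ^ 2 * p + M * C := by
  obtain ⟨k, hk⟩ := exists_gridObj_eq_maxObj (A := A) (K := K) (z := z) (l := l) p v c
  rw [← hk, gridObj]
  have h1 := abs_le.1 (abs_pairB_le (z := z) hc hl (gridPt A K k))
  have h2 := sq_sub_le_of_abs_le (gridPt_mem hA hK k) hv
  have h3 : p * (gridPt A K k - v) ^ 2 ≤ p * (4 * A ^ 2) := by gcongr
  have h4 : 0 ≤ p * (gridPt A K k - v) ^ 2 := by positivity
  rw [abs_le]
  constructor <;> linarith

/-! ### Risk decomposition and weak duality -/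

section Risk

variable {d : ℕ} {S : Type*} [MeasurableSpace S] {P : Measure (Obs d S)} [IsProbabilityMeasure P]
  {A : ℝ} {fStar : Feat d → S → ℝ}

lemma measurable_pred {g : RandPred d S} (hg : MeasurablePred g) :
    Measurable fun v : Obs d S × ℝ => g v.1.1 v.1.2.1 v.2 :=
  hg.comp (g := fun v : (Feat d × S) × ℝ => g v.1.1 v.1.2 v.2)
    (by fun_prop : Measurable fun v : Obs d S × ℝ => ((v.1.1, v.1.2.1), v.2))

lemma measurable_pred_group {g : RandPred d S} (hg : MeasurablePred g) (s : S) :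
    Measurable fun v : Obs d S × ℝ => g v.1.1 s v.2 :=
  hg.comp (g := fun v : (Feat d × S) × ℝ => g v.1.1 v.1.2 v.2)
    (by fun_prop : Measurable fun v : Obs d S × ℝ => ((v.1.1, s), v.2))

omit [IsProbabilityMeasure P] in
lemma IsBayes.measurable_group (hf : IsBayes P fStar) (s : S) :
    Measurable fun v : Obs d S × ℝ => fStar v.1.1 s :=
  hf.1.comp (g := fun v : Feat d × S => fStar v.1 v.2)
    (by fun_prop : Measurable fun v : Obs d S × ℝ => (v.1.1, s))

omit [IsProbabilityMeasure P] in
lemma IsBayes.ae_prod_abs_le (hY : ∀ᵐ w ∂P, |w.2.2| ≤ A) (hf : IsBayes P fStar) (ν : Measure ℝ)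
    [IsProbabilityMeasure ν] : ∀ᵐ v ∂(P.prod ν), |fStar v.1.1 v.1.2.1| ≤ A :=
  Measure.quasiMeasurePreserving_fst.ae (hf.ae_abs_le hY)

lemma IsBayes.ae_group_abs_le [MeasurableSingletonClass S] (hY : ∀ᵐ w ∂P, |w.2.2| ≤ A)
    (hf : IsBayes P fStar) (ν : Measure ℝ) [IsProbabilityMeasure ν] (s : S) :
    ∀ᵐ v ∂((groupLaw P s).prod ν), |fStar v.1.1 s| ≤ A := by
  filter_upwards [(groupLaw_prod_absolutelyContinuous ν s).ae_le (hf.ae_prod_abs_le hY ν),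
    ae_groupLaw_prod_mem ν s] with v h1 h2
  rwa [h2] at h1

/-- Bias-variance decomposition of the risk. -/
lemma risk_eq (hY : ∀ᵐ w ∂P, |w.2.2| ≤ A) (hf : IsBayes P fStar) (u : ℝ)
    {g : RandPred d S} (hg : MeasurablePred g) (hgA : ∀ x s ξ, |g x s ξ| ≤ A) :
    risk P u g = ∫ w, (w.2.2 - fStar w.1 w.2.1) ^ 2 ∂P
      + ∫ v, (g v.1.1 v.1.2.1 v.2 - fStar v.1.1 v.1.2.1) ^ 2 ∂(P.prod (ditherLaw u)) := by
  set ν := ditherLaw u with hν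
  have hYp : ∀ᵐ v ∂(P.prod ν), |v.1.2.2| ≤ A := Measure.quasiMeasurePreserving_fst.ae hY
  have hfp := hf.ae_prod_abs_le hY ν
  have hfm : Measurable fun v : Obs d S × ℝ => fStar v.1.1 v.1.2.1 :=
    hf.measurable.comp measurable_fst
  have hgm := measurable_pred hg
  have hym : Measurable fun v : Obs d S × ℝ => v.1.2.2 := by fun_prop
  have h2A : ∀ {a b : ℝ}, |a| ≤ A → |b| ≤ A → |a - b| ≤ 2 * A := fun {a b} ha hb =>
    (abs_sub _ _).trans (by linarith)
  have i1 : Integrable (fun v : Obs d S × ℝ => (v.1.2.2 - fStar v.1.1 v.1.2.1) ^ 2) (P.prod ν) := by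
    refine Integrable.of_bound ((hym.sub hfm).pow_const 2).aestronglyMeasurable (4 * A ^ 2) ?_
    filter_upwards [hYp, hfp] with v h1 h2
    rw [Real.norm_eq_abs, abs_of_nonneg (sq_nonneg _)]
    exact sq_sub_le_of_abs_le h1 h2
  have i2 : Integrable (fun v : Obs d S × ℝ =>
      (g v.1.1 v.1.2.1 v.2 - fStar v.1.1 v.1.2.1) ^ 2) (P.prod ν) := by
    refine Integrable.of_bound ((hgm.sub hfm).pow_const 2).aestronglyMeasurable (4 * A ^ 2) ?_
    filter_upwards [hfp] with v h2
    rw [Real.norm_eq_abs, abs_of_nonneg (sq_nonneg _)]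
    exact sq_sub_le_of_abs_le (hgA _ _ _) h2
  have i3 : Integrable (fun v : Obs d S × ℝ => (v.1.2.2 - fStar v.1.1 v.1.2.1) *
      (g v.1.1 v.1.2.1 v.2 - fStar v.1.1 v.1.2.1)) (P.prod ν) := by
    refine Integrable.of_bound ((hym.sub hfm).mul (hgm.sub hfm)).aestronglyMeasurable
      (2 * A * (2 * A)) ?_
    filter_upwards [hYp, hfp] with v h1 h2
    rw [Real.norm_eq_abs, abs_mul]
    exact mul_le_mul (h2A h1 h2) (h2A (hgA _ _ _) h2) (abs_nonneg _)
      ((abs_nonneg _).trans (h2A h1 h2))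
  have hcross : ∫ v : Obs d S × ℝ, (v.1.2.2 - fStar v.1.1 v.1.2.1) *
      (g v.1.1 v.1.2.1 v.2 - fStar v.1.1 v.1.2.1) ∂(P.prod ν) = 0 := by
    -- With the dithering variable integrated last, the predictor is a function of `(x, s)` for each
    -- fixed `ξ`, and orthogonality applies.
    rw [integral_prod_symm _ i3]
    refine integral_eq_zero_of_ae (Filter.Eventually.of_forall fun ξ => ?_)
    refine hf.integral_mul_eq_zero hY (k := fun x s => g x s ξ - fStar x s) (C := 2 * A) ?_ ?_
    · refine Measurable.sub ?_ hf.1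
      exact hg.comp (g := fun v : (Feat d × S) × ℝ => g v.1.1 v.1.2 v.2)
        (by fun_prop : Measurable fun v : Feat d × S => (v, ξ))
    · filter_upwards [hf.ae_abs_le hY] with w hw
      exact h2A (hgA _ _ _) hw
  have hfst : ∫ w, (w.2.2 - fStar w.1 w.2.1) ^ 2 ∂P
      = ∫ v, (v.1.2.2 - fStar v.1.1 v.1.2.1) ^ 2 ∂(P.prod ν) := by
    rw [integral_fun_fst (μ := P) (ν := ν) fun w => (w.2.2 - fStar w.1 w.2.1) ^ 2]
    simp
  rw [hfst, ← integral_add i1 i2, risk, ← sub_eq_zero, ← integral_sub]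
  · have : ∀ v : Obs d S × ℝ, (v.1.2.2 - g v.1.1 v.1.2.1 v.2) ^ 2
        - ((v.1.2.2 - fStar v.1.1 v.1.2.1) ^ 2 + (g v.1.1 v.1.2.1 v.2 - fStar v.1.1 v.1.2.1) ^ 2)
        = -2 * ((v.1.2.2 - fStar v.1.1 v.1.2.1) *
          (g v.1.1 v.1.2.1 v.2 - fStar v.1.1 v.1.2.1)) := fun v => by ring
    simp only [this]
    rw [integral_const_mul, hcross, mul_zero]
  · refine Integrable.of_bound ((hym.sub hgm).pow_const 2).aestronglyMeasurable (4 * A ^ 2) ?_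
    filter_upwards [hYp] with v h1
    rw [Real.norm_eq_abs, abs_of_nonneg (sq_nonneg _)]
    exact sq_sub_le_of_abs_le h1 (hgA _ _ _)
  · exact i1.add i2

variable [MeasurableSingletonClass S] {M K : ℕ} {z l : Fin M → ℝ}

omit [MeasurableSingletonClass S] in
lemma integral_pairB (hs : ∀ s, 0 < groupWeight P s) (u : ℝ) {g : RandPred d S}
    (hg : MeasurablePred g) (c : Fin M → ℝ) (s : S) :
    ∫ v, pairB z l c (g v.1.1 s v.2) ∂((groupLaw P s).prod (ditherLaw u))
      = ∑ m, c m * (groupCDF P u g s (z m) - l m) := by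
  have := isProbabilityMeasure_groupLaw (hs s)
  have hgm := measurable_pred_group hg s
  have hms : ∀ t, MeasurableSet {v : Obs d S × ℝ | g v.1.1 s v.2 ≤ t} := fun t =>
    measurableSet_le hgm measurable_const
  have hind : ∀ t, (fun v : Obs d S × ℝ => if g v.1.1 s v.2 ≤ t then (1 : ℝ) else 0)
      = Set.indicator {v | g v.1.1 s v.2 ≤ t} 1 := by
    intro t; funext v; simp [Set.indicator_apply]
  have hi : ∀ t, Integrable (fun v : Obs d S × ℝ => if g v.1.1 s v.2 ≤ t then (1 : ℝ) else 0)
      ((groupLaw P s).prod (ditherLaw u)) := by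
    intro t
    rw [hind]
    exact (integrable_const (1 : ℝ)).indicator (hms t)
  unfold pairB
  rw [integral_finsetSum (f := fun m (v : Obs d S × ℝ) =>
    c m * ((if g v.1.1 s v.2 ≤ z m then (1 : ℝ) else 0) - l m)) _
    fun m _ => ((hi _).sub (integrable_const _)).const_mul _]
  refine Finset.sum_congr rfl fun m _ => ?_
  rw [integral_const_mul, integral_sub (hi _) (integrable_const _), hind,
    integral_indicator_one (hms _)]
  simp [groupCDF]

lemma integrable_sq_group (hs : ∀ s, 0 < groupWeight P s) (hY : ∀ᵐ w ∂P, |w.2.2| ≤ A)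
    (hf : IsBayes P fStar) (ν : Measure ℝ) [IsProbabilityMeasure ν] {g : RandPred d S}
    (hg : MeasurablePred g) (hgA : ∀ x s ξ, |g x s ξ| ≤ A) (s : S) :
    Integrable (fun v : Obs d S × ℝ => (g v.1.1 s v.2 - fStar v.1.1 s) ^ 2)
      ((groupLaw P s).prod ν) := by
  have := isProbabilityMeasure_groupLaw (hs s)
  refine Integrable.of_bound (((measurable_pred_group hg s).sub
    (hf.measurable_group s)).pow_const 2).aestronglyMeasurable (4 * A ^ 2) ?_
  filter_upwards [hf.ae_group_abs_le hY ν s] with v h2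
  rw [Real.norm_eq_abs, abs_of_nonneg (sq_nonneg _)]
  exact sq_sub_le_of_abs_le (hgA _ _ _) h2

omit [MeasurableSingletonClass S] in
lemma integrable_pairB_group (hs : ∀ s, 0 < groupWeight P s)
    (hl : ∀ m, l m ∈ Set.Ioo (0 : ℝ) 1) (ν : Measure ℝ) [IsProbabilityMeasure ν]
    {g : RandPred d S} (hg : MeasurablePred g) (c : Fin M → ℝ) (s : S) :
    Integrable (fun v : Obs d S × ℝ => pairB z l c (g v.1.1 s v.2)) ((groupLaw P s).prod ν) := by
  have := isProbabilityMeasure_groupLaw (hs s)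
  exact Integrable.of_bound ((measurable_pairB z l c).comp
    (measurable_pred_group hg s)).aestronglyMeasurable (M * ∑ m, |c m|)
    (Filter.Eventually.of_forall fun v => abs_pairB_le (abs_multiplier_le_sum c) hl _)

lemma integrable_maxObj_group [NeZero K] (hA : 0 ≤ A) (hK : 2 ≤ K)
    (hs : ∀ s, 0 < groupWeight P s) (hY : ∀ᵐ w ∂P, |w.2.2| ≤ A) (hf : IsBayes P fStar)
    (hl : ∀ m, l m ∈ Set.Ioo (0 : ℝ) 1) (ν : Measure ℝ) [IsProbabilityMeasure ν]
    (c : Fin M → ℝ) (s : S) :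
    Integrable (fun v : Obs d S × ℝ => maxObj A K z l (groupWeight P s) (fStar v.1.1 s) c)
      ((groupLaw P s).prod ν) := by
  have := isProbabilityMeasure_groupLaw (hs s)
  refine Integrable.of_bound ((measurable_maxObj A K z l _ c).comp
    (hf.measurable_group s)).aestronglyMeasurable
    (4 * A ^ 2 * groupWeight P s + M * ∑ m, |c m|) ?_
  filter_upwards [hf.ae_group_abs_le hY ν s] with v h2
  exact abs_maxObj_le hA hK hl (hs s).le h2 (abs_multiplier_le_sum c)

/-- The penalized risk, group by group. -/
lemma penRisk_eq [Fintype S] (hs : ∀ s, 0 < groupWeight P s) (hY : ∀ᵐ w ∂P, |w.2.2| ≤ A)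
    (hf : IsBayes P fStar) (hl : ∀ m, l m ∈ Set.Ioo (0 : ℝ) 1) (u : ℝ) {g : RandPred d S}
    (hg : MeasurablePred g) (hgA : ∀ x s ξ, |g x s ξ| ≤ A) (lam : S → Fin M → ℝ) :
    penRisk P u z l lam g = ∫ w, (w.2.2 - fStar w.1 w.2.1) ^ 2 ∂P
      + ∑ s, ∫ v, (groupWeight P s * (g v.1.1 s v.2 - fStar v.1.1 s) ^ 2
          + pairB z l (lam s) (g v.1.1 s v.2)) ∂((groupLaw P s).prod (ditherLaw u)) := by
  rw [penRisk, risk_eq hY hf u hg hgA, add_assoc]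
  congr 1
  rw [integral_eq_sum_groups (ditherLaw u) hs
    (fun s v => (g v.1.1 s v.2 - fStar v.1.1 s) ^ 2), ← Finset.sum_add_distrib]
  · refine Finset.sum_congr rfl fun s _ => ?_
    rw [integral_add ((integrable_sq_group hs hY hf _ hg hgA s).const_mul _)
      (integrable_pairB_group hs hl _ hg _ s), integral_const_mul, integral_pairB hs u hg]
  · refine Integrable.of_bound (((measurable_pred hg).sub
      (hf.measurable.comp measurable_fst)).pow_const 2).aestronglyMeasurable (4 * A ^ 2) ?_
    filter_upwards [hf.ae_prod_abs_le hY (ditherLaw u)] with v h2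
    rw [Real.norm_eq_abs, abs_of_nonneg (sq_nonneg _)]
    exact sq_sub_le_of_abs_le (hgA _ _ _) h2

omit [MeasurableSingletonClass S] in
lemma dualObj_eq [Fintype S] (hs : ∀ s, 0 < groupWeight P s) (ν : Measure ℝ)
    [IsProbabilityMeasure ν] (lam : S → Fin M → ℝ) :
    dualObj P fStar A K z l lam = ∑ s, ∫ v, maxObj A K z l (groupWeight P s) (fStar v.1.1 s)
      (lam s) ∂((groupLaw P s).prod ν) := by
  refine Finset.sum_congr rfl fun s _ => ?_
  have := isProbabilityMeasure_groupLaw (hs s)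
  rw [integral_fun_fst (μ := groupLaw P s) (ν := ν)
    fun w => maxObj A K z l (groupWeight P s) (fStar w.1 s) (lam s)]
  simp [maxObj, gridObj]

/-- Weak duality. -/
lemma neg_dualObj_le_penRisk [Fintype S] [NeZero K] (hA : 0 ≤ A) (hK : 2 ≤ K)
    (hs : ∀ s, 0 < groupWeight P s) (hY : ∀ᵐ w ∂P, |w.2.2| ≤ A)
    (hf : IsBayes P fStar) (hl : ∀ m, l m ∈ Set.Ioo (0 : ℝ) 1) (u : ℝ) {g : RandPred d S}
    (hg : MeasurablePred g) (hgK : ∀ x s ξ, g x s ξ ∈ Set.range (gridPt A K))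
    (lam : S → Fin M → ℝ) :
    ∫ w, (w.2.2 - fStar w.1 w.2.1) ^ 2 ∂P - dualObj P fStar A K z l lam
      ≤ penRisk P u z l lam g := by
  have hgA : ∀ x s ξ, |g x s ξ| ≤ A := fun x s ξ => by
    obtain ⟨k, hk⟩ := hgK x s ξ
    rw [← hk]; exact gridPt_mem hA hK k
  rw [penRisk_eq hs hY hf hl u hg hgA, dualObj_eq hs (ditherLaw u), sub_eq_add_neg,
    ← Finset.sum_neg_distrib]
  gcongr with s
  rw [← integral_neg]
  refine integral_mono (integrable_maxObj_group hA hK hs hY hf hl _ _ s).neg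
    (((integrable_sq_group hs hY hf _ hg hgA s).const_mul _).add
      (integrable_pairB_group hs hl _ hg _ s)) fun v => ?_
  obtain ⟨k, hk⟩ := hgK v.1.1 s v.2
  have := gridObj_le_maxObj (A := A) (z := z) (l := l) (groupWeight P s) (fStar v.1.1 s) (lam s) k
  simp only [gridObj, hk] at this
  simp only
  linarith

end Risk

/-- The objective is separable, so changing one block alone shows that each block is optimal; the
dual problems split over the groups. -/
lemma le_of_isMinOn_sum {S β : Type*} [Fintype S] [DecidableEq S] {h : S → β → ℝ} {x : S → β}
    (hmin : IsMinOn (fun x : S → β => ∑ s, h s (x s)) Set.univ x) (s : S) (c : β) :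
    h s (x s) ≤ h s c := by
  have h1 := isMinOn_iff.1 hmin (Function.update x s c) (Set.mem_univ _)
  by_contra hcon
  push Not at hcon
  refine absurd h1 (not_le.2 (Finset.sum_lt_sum (fun s' _ => ?_) ⟨s, Finset.mem_univ s, ?_⟩))
  · by_cases hs : s' = s
    · subst hs; simpa using hcon.le
    · simp [hs]
  · simpa using hcon

/-! ### Feasibility, grid points, and the population multipliers -/

section Classes

variable {d : ℕ} {S : Type*} [MeasurableSpace S] [MeasurableSingletonClass S]
  {P : Measure (Obs d S)} [IsProbabilityMeasure P] {A : ℝ} {M K : ℕ} {z l : Fin M → ℝ}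
  {f : Feat d → S → ℝ}

omit [MeasurableSingletonClass S] in
lemma groupCDF_le_of_imp {s : S} (hs : 0 < groupWeight P s) {u : ℝ} {g g' : RandPred d S}
    {t t' : ℝ} (h : ∀ x ξ, g x s ξ ≤ t → g' x s ξ ≤ t') :
    groupCDF P u g s t ≤ groupCDF P u g' s t' := by
  have := isProbabilityMeasure_groupLaw hs
  exact measureReal_mono fun v hv => h v.1.1 v.2 hv

omit [MeasurableSingletonClass S] in
/-- Feasibility puts a grid point right below each threshold. -/
lemma exists_gridPt_le_of_fairClass (hf : f ∈ fairClass P A K z l) {s : S}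
    (hs : 0 < groupWeight P s) (hl : ∀ m, l m ∈ Set.Ioo (0 : ℝ) 1) (hlm : StrictMono l)
    (hzm : StrictMono z) (m : Fin M) :
    ∃ k, gridPt A K k ≤ z m ∧ ∀ m' < m, z m' < gridPt A K k := by
  by_contra hcon
  push Not at hcon
  -- An empty class would force `ℓ_m ≤ ℓ_{m-1}`, or `ℓ_m = 0` for the first threshold.
  have hfg : ∀ x, f x s ≤ z m → ∃ m' < m, f x s ≤ z m' := fun x hx => by
    obtain ⟨k, hk⟩ := hf.2.1 x s
    rw [← hk] at hx ⊢
    exact hcon k hx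
  by_cases hfirst : 0 < (m : ℕ)
  · set m₁ : Fin M := ⟨m - 1, by omega⟩ with hm₁
    have hlt : m₁ < m := Fin.lt_def.2 (by simp only [hm₁]; omega)
    have h1 := groupCDF_le_of_imp (P := P) (u := 0) (g := detPred f) (g' := detPred f) hs
      (t := z m) (t' := z m₁) fun x _ hx => by
        obtain ⟨m', hm', h⟩ := hfg x hx
        refine h.trans (hzm.monotone (Fin.le_def.2 ?_))
        simp only [hm₁]; have := Fin.lt_def.1 hm'; omega
    rw [hf.2.2, hf.2.2] at h1
    exact absurd (hlm hlt) (not_lt.2 h1)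
  · have h1 := hf.2.2 s m
    have : {v : Obs d S × ℝ | detPred f v.1.1 s v.2 ≤ z m} = ∅ := by
      ext v
      simp only [Set.mem_ofPred_eq, Set.mem_empty_iff_false, iff_false]
      intro hv
      obtain ⟨m', hm', _⟩ := hfg v.1.1 hv
      have := Fin.lt_def.1 hm'; omega
    rw [groupCDF, this, measureReal_empty] at h1
    exact absurd (hl m).1 (by rw [← h1]; exact lt_irrefl 0)

omit [MeasurableSingletonClass S] in
/-- Feasibility puts a grid point right above each threshold. -/
lemma exists_lt_gridPt_of_fairClass (hf : f ∈ fairClass P A K z l) {s : S}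
    (hs : 0 < groupWeight P s) (hl : ∀ m, l m ∈ Set.Ioo (0 : ℝ) 1) (hlm : StrictMono l)
    (hzm : StrictMono z) (m : Fin M) :
    ∃ k, z m < gridPt A K k ∧ ∀ m' > m, gridPt A K k ≤ z m' := by
  by_contra hcon
  push Not at hcon
  have hfg : ∀ x, z m < f x s → ∃ m' > m, z m' < f x s := fun x hx => by
    obtain ⟨k, hk⟩ := hf.2.1 x s
    rw [← hk] at hx ⊢
    exact hcon k hx
  by_cases hlast : (m : ℕ) + 1 < M
  · set m₁ : Fin M := ⟨m + 1, hlast⟩ with hm₁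
    have hlt : m < m₁ := Fin.lt_def.2 (by simp [hm₁])
    have h1 := groupCDF_le_of_imp (P := P) (u := 0) (g := detPred f) (g' := detPred f) hs
      (t := z m₁) (t' := z m) fun x _ hx => by
        by_contra h
        obtain ⟨m', hm', h'⟩ := hfg x (not_le.1 h)
        have : z m₁ ≤ z m' := hzm.monotone (Fin.le_def.2 (by simp only [hm₁]; exact hm'))
        exact absurd (this.trans_lt h') (not_lt.2 hx)
    rw [hf.2.2, hf.2.2] at h1
    exact absurd (hlm hlt) (not_lt.2 h1)
  · have h1 := hf.2.2 s m
    have : {v : Obs d S × ℝ | detPred f v.1.1 s v.2 ≤ z m} = Set.univ := by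
      ext v
      simp only [Set.mem_ofPred_eq, Set.mem_univ, iff_true]
      by_contra hv
      obtain ⟨m', hm', _⟩ := hfg v.1.1 (not_le.1 hv)
      have := Fin.lt_def.1 hm'; have := m'.2; omega
    have hp := isProbabilityMeasure_groupLaw hs
    rw [groupCDF, this, probReal_univ] at h1
    exact absurd (hl m).2 (by rw [← h1]; exact lt_irrefl 1)

lemma abs_lamStar_le [Fintype S] [DecidableEq S] [NeZero K] {fStar : Feat d → S → ℝ}
    (hA : 0 ≤ A) (hK : 2 ≤ K)
    (hs : ∀ s, 0 < groupWeight P s) (hY : ∀ᵐ w ∂P, |w.2.2| ≤ A)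
    (hB : IsBayes P fStar) (hl : ∀ m, l m ∈ Set.Ioo (0 : ℝ) 1) (hlm : StrictMono l)
    (hzm : StrictMono z) (hf : f ∈ fairClass P A K z l) {lam : S → Fin M → ℝ}
    (hlam : IsMinOn (dualObj P fStar A K z l) Set.univ lam) (s : S) (m : Fin M) :
    |lam s m| ≤ 4 * A ^ 2 * groupWeight P s := by
  refine abs_multiplier_le hA hK (hs s).le hl hlm hzm
    (exists_gridPt_le_of_fairClass hf (hs s) hl hlm hzm)
    (exists_lt_gridPt_of_fairClass hf (hs s) hl hlm hzm) (fun e ε b hε hb hcon => ?_) m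
  rw [show dualObj P fStar A K z l = _ from funext (dualObj_eq hs (ditherLaw 0))] at hlam
  have hle := le_of_isMinOn_sum (h := fun s c => ∫ v : Obs d S × ℝ,
    maxObj A K z l (groupWeight P s) (fStar v.1.1 s) c ∂((groupLaw P s).prod (ditherLaw 0)))
    hlam s (lam s + ε • e)
  have := isProbabilityMeasure_groupLaw (hs s)
  have hlt := integral_mono_ae
    (integrable_maxObj_group hA hK hs hY hB hl (ditherLaw 0) (lam s + ε • e) s)
    ((integrable_maxObj_group hA hK hs hY hB hl (ditherLaw 0) (lam s) s).sub
      (integrable_const (ε * b)))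
    (by
      filter_upwards [hB.ae_group_abs_le hY (ditherLaw 0) s] with v hv
      exact hcon _ hv)
  simp only [Pi.sub_apply] at hlt
  rw [integral_sub (integrable_maxObj_group hA hK hs hY hB hl _ _ s) (integrable_const _)] at hlt
  simp only [integral_const, probReal_univ, one_smul] at hlt
  have := mul_pos hε hb
  linarith

end Classes

/-! ### Dithered values and the empirical multipliers -/

section Dither

variable {d : ℕ} {S : Type*} {A : ℝ} {h : Feat d → S → ℝ}

lemma abs_dithered_le (hA : 0 ≤ A) (x : Feat d) (s : S) (ξ : ℝ) : |dithered A h x s ξ| ≤ A := by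
  unfold dithered
  rw [abs_le]
  exact ⟨le_max_left _ _, max_le (by linarith) (min_le_left _ _)⟩

/-- The projection is 1-Lipschitz and fixes `a`. -/
lemma abs_sub_dithered_le {a : ℝ} (ha : |a| ≤ A) (x : Feat d) (s : S) {u ξ : ℝ}
    (hξ : 0 ≤ ξ ∧ ξ ≤ u) : |a - dithered A h x s ξ| ≤ |h x s - a| + u := by
  have ha' := abs_le.1 ha
  have h1 : |max (-A) (min A a) - max (-A) (min A (h x s + ξ))| ≤ |a - (h x s + ξ)| :=
    (abs_max_sub_max_le_max _ _ _ _).trans (by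
      rw [sub_self, abs_zero]
      refine max_le (abs_nonneg _) ?_
      refine (abs_min_sub_min_le_max _ _ _ _).trans ?_
      rw [sub_self, abs_zero]
      exact max_le (abs_nonneg _) le_rfl)
  rw [min_eq_right ha'.2, max_eq_right ha'.1] at h1
  refine h1.trans ?_
  calc |a - (h x s + ξ)| = |(a - h x s) - ξ| := by ring_nf
    _ ≤ |a - h x s| + |ξ| := abs_sub _ _
    _ ≤ |h x s - a| + u := by rw [abs_sub_comm, abs_of_nonneg hξ.1]; linarith [hξ.2]

variable [MeasurableSpace S]

lemma measurablePred_dithered (hh : Measurable fun v : Feat d × S => h v.1 v.2) :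
    MeasurablePred (dithered A h) := by
  unfold MeasurablePred dithered
  have : Measurable fun v : (Feat d × S) × ℝ => h v.1.1 v.1.2 := hh.comp measurable_fst
  fun_prop

end Dither

section EmpiricalDual

variable {d : ℕ} {S : Type*} [Fintype S] [DecidableEq S] {A : ℝ} {M K N : ℕ} {z l : Fin M → ℝ}
  {h : Feat d → S → ℝ} {D : Fin N → CalPt d S} {lam : S → Fin M → ℝ}

lemma sum_maxObj_le_of_isMinOn (hlam : IsMinOn (empDualObj h A K z l D) Set.univ lam) {s : S}
    (hN : 0 < groupCount D s) (c : Fin M → ℝ) :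
    ∑ i with (D i).1.2 = s, maxObj A K z l (empWeight D s) (dithered A h (D i).1.1 s (D i).2)
        (lam s)
      ≤ ∑ i with (D i).1.2 = s, maxObj A K z l (empWeight D s)
        (dithered A h (D i).1.1 s (D i).2) c := by
  have := le_of_isMinOn_sum (h := fun s c => (groupCount D s : ℝ)⁻¹ * ∑ i with (D i).1.2 = s,
    maxObj A K z l (empWeight D s) (dithered A h (D i).1.1 s (D i).2) c) hlam s c
  exact le_of_mul_le_mul_left this (by positivity)

omit [Fintype S] in
lemma empWeight_mem (D : Fin N → CalPt d S) (s : S) : 0 ≤ empWeight D s ∧ empWeight D s ≤ 1 := by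
  unfold empWeight groupCount
  refine ⟨by positivity, div_le_one_of_le₀ ?_ (by positivity)⟩
  exact_mod_cast (Finset.card_filter_le _ _).trans (by simp)

lemma abs_lamHat_le [NeZero K] (hA : 0 ≤ A) (hK : 2 ≤ K)
    (hl : ∀ m, l m ∈ Set.Ioo (0 : ℝ) 1) (hlm : StrictMono l) (hzm : StrictMono z)
    (hlow : ∀ m, ∃ k, gridPt A K k ≤ z m ∧ ∀ m' < m, z m' < gridPt A K k)
    (hupp : ∀ m, ∃ k, z m < gridPt A K k ∧ ∀ m' > m, gridPt A K k ≤ z m')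
    (hlam : IsMinOn (empDualObj h A K z l D) Set.univ lam) {s : S}
    (hN : 0 < groupCount D s) (m : Fin M) :
    |lam s m| ≤ 4 * A ^ 2 * empWeight D s := by
  refine abs_multiplier_le hA hK (empWeight_mem D s).1 hl hlm hzm hlow hupp
    (fun e ε b hε hb hcon => ?_) m
  have h1 := sum_maxObj_le_of_isMinOn hlam hN (lam s + ε • e)
  have h2 := h1.trans (Finset.sum_le_sum fun i _ =>
    hcon (dithered A h (D i).1.1 s (D i).2) (abs_dithered_le hA _ _ _))
  rw [Finset.sum_sub_distrib, Finset.sum_const, nsmul_eq_mul] at h2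
  have h3 : (0 : ℝ) < groupCount D s := by exact_mod_cast hN
  have h4 := mul_pos h3 (mul_pos hε hb)
  unfold groupCount at h4
  linarith

end EmpiricalDual

/-! ### Unfairness of the post-processed predictor -/

section Unfairness

variable {d : ℕ} {S : Type*} [Fintype S] [DecidableEq S] [MeasurableSpace S]
  [MeasurableSingletonClass S] {P : Measure (Obs d S)} [IsProbabilityMeasure P]
  {A : ℝ} {M K N : ℕ} {z l : Fin M → ℝ}
  {h : Feat d → S → ℝ} {D : Fin N → CalPt d S} {lam : S → Fin M → ℝ}

/-- The number of calibration points of group `s` with dithered value at most `t`. -/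
def countBelow (h : Feat d → S → ℝ) (A : ℝ) (D : Fin N → CalPt d S) (s : S) (t : ℝ) : ℕ :=
  (Finset.univ.filter fun i => (D i).1.2 = s ∧ dithered A h (D i).1.1 s (D i).2 ≤ t).card

/-- The calibration counts of all the half-lines are within `N η` of their means. -/
def UniformlyClose (P : Measure (Obs d S)) (u : ℝ) (h : Feat d → S → ℝ) (A : ℝ)
    (D : Fin N → CalPt d S) (η : ℝ) : Prop :=
  ∀ s, ∀ q : ℚ,
    |(countBelow h A D s q : ℝ) - N * (groupWeight P s * groupCDF P u (dithered A h) s q)| ≤ N * η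

omit [MeasurableSingletonClass S] [Fintype S] in
lemma abs_groupCount_sub_le (hA : 0 ≤ A) {u η : ℝ} (hs : ∀ s, 0 < groupWeight P s)
    (hD : UniformlyClose P u h A D η) (s : S) :
    |(groupCount D s : ℝ) - N * groupWeight P s| ≤ N * η := by
  -- A half-line beyond `A` contains every dithered value, so the group counts are a special case.
  obtain ⟨q, hq⟩ := exists_rat_gt A
  have hle : ∀ x ξ, dithered A h x s ξ ≤ q := fun x ξ =>
    ((abs_le.1 (abs_dithered_le hA x s ξ)).2).trans hq.le
  have h1 := hD s q
  have h2 : countBelow h A D s q = groupCount D s := by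
    unfold countBelow groupCount
    congr 1
    ext i
    simp [hle]
  have := isProbabilityMeasure_groupLaw (hs s)
  have h3 : groupCDF P u (dithered A h) s q = 1 := by
    have : {v : Obs d S × ℝ | dithered A h v.1.1 s v.2 ≤ q} = Set.univ := by
      ext v; simp [hle]
    rw [groupCDF, this, probReal_univ]
  rwa [h2, h3, mul_one] at h1

omit [MeasurableSingletonClass S] [Fintype S] in
lemma abs_empWeight_sub_le (hA : 0 ≤ A) (hN : 1 ≤ N) {u η : ℝ} (hs : ∀ s, 0 < groupWeight P s)
    (hD : UniformlyClose P u h A D η) (s : S) : |empWeight D s - groupWeight P s| ≤ η := by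
  have h1 := abs_groupCount_sub_le hA hs hD s
  have hN' : (0 : ℝ) < N := by exact_mod_cast hN
  have h2 : empWeight D s - groupWeight P s
      = ((groupCount D s : ℝ) - N * groupWeight P s) / N := by
    unfold empWeight; field_simp
  rw [h2, abs_div, abs_of_pos hN', div_le_iff₀ hN', mul_comm η]
  exact h1

omit [MeasurableSingletonClass S] [Fintype S] [DecidableEq S] in
lemma monotone_groupCDF {s : S} (hs : 0 < groupWeight P s) (u : ℝ) (g : RandPred d S) :
    Monotone (groupCDF P u g s) := fun _ _ hab =>
  groupCDF_le_of_imp hs fun _ _ hx => hx.trans hab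

omit [MeasurableSingletonClass S] in
/-- The post-processed predictor almost satisfies the constraints. -/
lemma groupWeight_mul_abs_unfairness_le [NeZero K] (hA : 0 ≤ A) (hN : 1 ≤ N)
    {u η : ℝ} (hs : ∀ s, 0 < groupWeight P s)
    (hl : ∀ m, l m ∈ Set.Ioo (0 : ℝ) 1) (hD : UniformlyClose P u h A D η)
    (hcont : ∀ s, Continuous (groupCDF P u (dithered A h) s))
    (hlam : IsMinOn (empDualObj h A K z l D) Set.univ lam) {g : RandPred d S}
    (hg : IsPostProcessed h A K z D lam g) {s : S} (hNs : 0 < groupCount D s) (m : Fin M) :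
    groupWeight P s * |groupCDF P u g s (z m) - l m| ≤ 2 * η := by
  have hN' : (0 : ℝ) < N := by exact_mod_cast hN
  have hp : 0 < empWeight D s := by unfold empWeight; positivity
  obtain ⟨t, ht⟩ := exists_threshold (A := A) hp (pairA z (lam s)) (Set.range (gridPt A K)) (z m)
  set F := groupCDF P u (dithered A h) s with hF
  have hFm : Monotone F := monotone_groupCDF (hs s) u _
  -- The event `g ≤ z m` lies between `f̄ < t` and `f̄ ≤ t`, which have the same probability by
  -- continuity. Whatever choice `g` makes at `t` is thus irrelevant.
  have hFg : groupCDF P u g s (z m) = F t := by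
    apply le_antisymm
    · refine groupCDF_le_of_imp (hs s) fun x ξ hx => ?_
      by_contra hcon
      obtain ⟨h1, h2⟩ := hg.2 x s ξ
      exact absurd ((ht _ (abs_dithered_le hA x s ξ) _ h1 h2).2 (not_le.1 hcon)) (not_lt.2 hx)
    · refine le_of_tendsto ((hcont s).continuousAt.tendsto.mono_left
        (nhdsWithin_le_nhds (a := t) (s := Set.Iio t))) ?_
      filter_upwards [self_mem_nhdsWithin] with x hx
      refine groupCDF_le_of_imp (hs s) fun y ξ hy => ?_
      obtain ⟨h1, h2⟩ := hg.2 y s ξ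
      exact (ht _ (abs_dithered_le hA y s ξ) _ h1 h2).1 (lt_of_le_of_lt hy hx)
  have hcard := card_lt_threshold_le (Finset.univ.filter fun i => (D i).1.2 = s)
    (fun i => dithered A h (D i).1.1 s (D i).2) (sum_maxObj_le_of_isMinOn hlam hNs) m (t := t)
    (fun i _ y hy hy' => ht _ (abs_dithered_le hA _ _ _) y hy hy')
  rw [Finset.filter_filter, Finset.filter_filter] at hcard
  change _ ≤ (groupCount D s : ℝ) * l m ∧ (groupCount D s : ℝ) * l m ≤ (countBelow h A D s t : ℝ)
    at hcard
  -- Closeness is known only at rational thresholds; continuity of `F` lets them approach `t` from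
  -- the right here and from the left in `hlo`.
  have hup : (groupCount D s : ℝ) * l m ≤ N * (groupWeight P s * F t) + N * η := by
    have hc : Continuous fun x => N * (groupWeight P s * F x) + N * η := by
      have := hcont s
      fun_prop
    refine ge_of_tendsto (hc.continuousAt.tendsto.mono_left
        (nhdsWithin_le_nhds (a := t) (s := Set.Ioi t))) ?_
    filter_upwards [self_mem_nhdsWithin] with x hx
    obtain ⟨q, hq1, hq2⟩ := exists_rat_btwn (Set.mem_Ioi.1 hx)
    have h1 : (countBelow h A D s t : ℝ) ≤ countBelow h A D s q := by
      exact_mod_cast Finset.card_le_card fun i hi => by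
        simp only [Finset.mem_filter] at hi ⊢
        exact ⟨hi.1, hi.2.1, hi.2.2.trans hq1.le⟩
    have h2 := (abs_le.1 (hD s q)).2
    have h3 : (N : ℝ) * (groupWeight P s * F q) ≤ N * (groupWeight P s * F x) := by
      have := hFm hq2.le
      have := (hs s).le
      gcongr
    linarith [hcard.2]
  have hlo : N * (groupWeight P s * F t) - N * η ≤ (groupCount D s : ℝ) * l m := by
    have hc : Continuous fun x => N * (groupWeight P s * F x) - N * η := by
      have := hcont s
      fun_prop
    refine le_of_tendsto (hc.continuousAt.tendsto.mono_left
        (nhdsWithin_le_nhds (a := t) (s := Set.Iio t))) ?_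
    filter_upwards [self_mem_nhdsWithin] with x hx
    obtain ⟨q, hq1, hq2⟩ := exists_rat_btwn (Set.mem_Iio.1 hx)
    have h1 : (countBelow h A D s q : ℝ) ≤ (groupCount D s : ℝ) * l m := by
      refine le_trans ?_ hcard.1
      exact_mod_cast Finset.card_le_card fun i hi => by
        simp only [Finset.mem_filter] at hi ⊢
        exact ⟨hi.1, hi.2.1, hi.2.2.trans_lt hq2⟩
    have h2 := (abs_le.1 (hD s q)).1
    have h3 : (N : ℝ) * (groupWeight P s * F x) ≤ N * (groupWeight P s * F q) := by
      have := hFm hq1.le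
      have := (hs s).le
      gcongr
    linarith
  have hcnt := abs_le.1 (abs_groupCount_sub_le hA hs hD s)
  have hη : 0 ≤ N * η := by linarith [hcnt.1, hcnt.2]
  have hlm := hl m
  -- One `η` comes from the half-line counts, the other from replacing `N_s` by its mean.
  have h4 : |N * (groupWeight P s * (F t - l m))| ≤ N * (2 * η) := by
    have e : N * (groupWeight P s * (F t - l m))
        = (N * (groupWeight P s * F t) - groupCount D s * l m)
          + ((groupCount D s : ℝ) - N * groupWeight P s) * l m := by ring
    rw [e, abs_le]
    have h5 := mul_le_mul_of_nonneg_right hcnt.1 hlm.1.le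
    have h6 := mul_le_mul_of_nonneg_right hcnt.2 hlm.1.le
    have h7 := mul_le_mul_of_nonneg_left hlm.2.le hη
    constructor <;> linarith
  rw [hFg]
  rw [abs_mul, abs_of_pos hN', abs_mul, abs_of_pos (hs s)] at h4
  exact le_of_mul_le_mul_left h4 hN'

end Unfairness

/-! ### Uniform deviation of the calibration counts -/

section Deviation

variable {d : ℕ} {S : Type*} [Fintype S] [DecidableEq S] [MeasurableSpace S]
  [MeasurableSingletonClass S] {P : Measure (Obs d S)} [IsProbabilityMeasure P]
  {A : ℝ} {h : Feat d → S → ℝ}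

instance isProbabilityMeasure_calLaw (u : ℝ) : IsProbabilityMeasure (calLaw P u) := by
  have : IsProbabilityMeasure (P.map fun w : Obs d S => (w.1, w.2.1)) :=
    Measure.isProbabilityMeasure_map (by fun_prop)
  unfold calLaw
  infer_instance

omit [Fintype S] [DecidableEq S] in
lemma measurableSet_calPt_below (hh : Measurable fun v : Feat d × S => h v.1 v.2) (s : S) (t : ℝ) :
    MeasurableSet {c : CalPt d S | c.1.2 = s ∧ dithered A h c.1.1 s c.2 ≤ t} := by
  have h1 : Measurable fun c : CalPt d S => dithered A h c.1.1 s c.2 :=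
    (measurablePred_dithered (A := A) hh).comp
      (g := fun v : (Feat d × S) × ℝ => dithered A h v.1.1 v.1.2 v.2)
      (by fun_prop : Measurable fun c : CalPt d S => ((c.1.1, s), c.2))
  exact (measurableSet_preimage (measurable_snd.comp measurable_fst)
    (measurableSet_singleton s)).inter (measurableSet_le h1 measurable_const)

omit [Fintype S] [DecidableEq S] in
lemma real_calLaw_below (hs : ∀ s, 0 < groupWeight P s)
    (hh : Measurable fun v : Feat d × S => h v.1 v.2) (u : ℝ) (s : S) (t : ℝ) :
    (calLaw P u).real {c | c.1.2 = s ∧ dithered A h c.1.1 s c.2 ≤ t}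
      = groupWeight P s * groupCDF P u (dithered A h) s t := by
  have hB : MeasurableSet {v : Obs d S × ℝ | dithered A h v.1.1 s v.2 ≤ t} :=
    measurableSet_le (measurable_pred_group (measurablePred_dithered hh) s) measurable_const
  have hφ : Measurable fun w : Obs d S => (w.1, w.2.1) := by fun_prop
  rw [groupCDF, real_groupLaw_prod _ (hs s) hB, calLaw]
  conv_lhs => rw [← Measure.map_id (μ := ditherLaw u)]
  rw [Measure.map_prod_map _ _ hφ measurable_id, map_measureReal_apply (hφ.prodMap measurable_id)
    (measurableSet_calPt_below hh s t)]
  congr 1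
  ext v
  exact and_comm

/-- The calibration counts are uniformly close to their means with high probability. -/
lemma measure_not_uniformlyClose_le (hs : ∀ s, 0 < groupWeight P s)
    (hh : Measurable fun v : Feat d × S => h v.1 v.2) (u : ℝ) (N : ℕ) {η : ℝ} (hη : 0 ≤ η) :
    (Measure.pi fun _ : Fin N => calLaw P u) {D | ¬ UniformlyClose P u h A D η}
      ≤ ENNReal.ofReal (Fintype.card S * (4 * Real.exp (-(N * η ^ 2 / 8)))) := by
  classical
  -- Points of other groups are sent to `⊤`, so belonging to group `s` with value at most `t`
  -- becomes a half-line event. The full sample of fixed size `N` can be used, without conditioning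
  -- on the random `N_s`.
  set V : S → CalPt d S → WithTop ℝ := fun s c =>
    if c.1.2 = s then ((dithered A h c.1.1 s c.2 : ℝ) : WithTop ℝ) else ⊤ with hV
  have hVle : ∀ s (t : ℝ), {c | V s c ≤ (t : WithTop ℝ)}
      = {c : CalPt d S | c.1.2 = s ∧ dithered A h c.1.1 s c.2 ≤ t} := by
    intro s t
    ext c
    by_cases hc : c.1.2 = s <;> simp [hV, hc]
  have hVm : ∀ s t, MeasurableSet {c | V s c ≤ t} := by
    intro s t
    induction t using WithTop.recTopCoe with
    | top => simp
    | coe t => rw [hVle]; exact measurableSet_calPt_below hh s t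
  set T : Set (WithTop ℝ) := Set.range fun q : ℚ => ((q : ℝ) : WithTop ℝ) with hT
  have hsub : {D : Fin N → CalPt d S | ¬ UniformlyClose P u h A D η} ⊆
      ⋃ s, {x | ∃ t ∈ T, η * Fintype.card (Fin N)
        ≤ |∑ i, (below (V s) t (x i) - (calLaw P u).real {e | V s e ≤ t})|} := by
    intro D hD
    simp only [UniformlyClose, Set.mem_ofPred_eq, not_forall, not_le] at hD
    obtain ⟨s, q, hq⟩ := hD
    refine Set.mem_iUnion.2 ⟨s, ((q : ℝ) : WithTop ℝ), ⟨q, rfl⟩, ?_⟩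
    have h1 : ∑ i, below (V s) ((q : ℝ) : WithTop ℝ) (D i) = (countBelow h A D s q : ℝ) := by
      rw [countBelow, Finset.card_filter]
      push_cast
      refine Finset.sum_congr rfl fun i _ => ?_
      have := Set.ext_iff.1 (hVle s q) (D i)
      simp only [Set.mem_ofPred_eq] at this
      simp only [below, this]
    rw [Finset.sum_sub_distrib, h1, hVle, real_calLaw_below hs hh]
    simp only [Finset.sum_const, Finset.card_univ, Fintype.card_fin, nsmul_eq_mul]
    rw [mul_comm]
    exact hq.le
  refine (measure_mono hsub).trans ((measure_iUnion_le _).trans ?_)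
  rw [tsum_fintype]
  calc _ ≤ ∑ _s : S, ENNReal.ofReal (4 * Real.exp (-(N * η ^ 2 / 8))) := by
        refine Finset.sum_le_sum fun s _ => ?_
        have := measure_exists_abs_sum_ge_le_of_countable (ι := Fin N) (calLaw P u) (hVm s)
          (T := T) (Set.countable_range _) hη
        simpa only [Fintype.card_fin] using this
    _ = _ := by
        rw [Finset.sum_const, nsmul_eq_mul, Finset.card_univ,
          ENNReal.ofReal_mul (p := (Fintype.card S : ℝ)) (by positivity), ENNReal.ofReal_natCast]

end Deviation

/-! ### The excess penalized risk -/

section Excess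

variable {M K : ℕ} {A : ℝ} {z l : Fin M → ℝ}

lemma abs_weighted_sq_sub_le {p p' a v y : ℝ} (hp : 0 ≤ p) (ha : |a| ≤ A) (hv : |v| ≤ A)
    (hy : |y| ≤ A) :
    |p * (y - a) ^ 2 - p' * (y - v) ^ 2| ≤ |p - p'| * (4 * A ^ 2) + p * (4 * A * |a - v|) := by
  have e : p * (y - a) ^ 2 - p' * (y - v) ^ 2
      = (p - p') * (y - v) ^ 2 + p * ((2 * y - a - v) * (v - a)) := by ring
  rw [e]
  refine (abs_add_le _ _).trans (add_le_add ?_ ?_)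
  · rw [abs_mul, abs_of_nonneg (sq_nonneg (y - v))]
    exact mul_le_mul_of_nonneg_left (sq_sub_le_of_abs_le hy hv) (abs_nonneg _)
  · rw [abs_mul, abs_of_nonneg hp, abs_mul, abs_sub_comm v a]
    have h1 : |2 * y - a - v| ≤ 4 * A := by
      have := abs_le.1 ha
      have := abs_le.1 hv
      have := abs_le.1 hy
      rw [abs_le]
      constructor <;> linarith
    gcongr

/-- Replacing `(p', v)` by `(p, a)` costs the same error at the competitor and at the minimizer,
hence the factor `2`. -/
lemma maxObj_le_of_isMinOn [NeZero K] (hA : 0 ≤ A) (hK : 2 ≤ K) {p p' a v y : ℝ} (hp : 0 ≤ p)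
    (ha : |a| ≤ A) (hv : |v| ≤ A) {c : Fin M → ℝ} (hy : y ∈ Set.range (gridPt A K))
    (hmin : IsMinOn (fun y => p' * (y - v) ^ 2 + pairA z c y) (Set.range (gridPt A K)) y) :
    maxObj A K z l p a c ≤ -(p * (y - a) ^ 2) - pairB z l c y
      + 2 * (|p - p'| * (4 * A ^ 2) + p * (4 * A * |a - v|)) := by
  refine maxObj_le fun k => ?_
  have h1 := isMinOn_iff.1 hmin _ ⟨k, rfl⟩
  have h2 := abs_le.1 (abs_weighted_sq_sub_le (p' := p') hp ha hv (gridPt_mem hA hK k))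
  obtain ⟨j, rfl⟩ := hy
  have h3 := abs_le.1 (abs_weighted_sq_sub_le (p' := p') hp ha hv (gridPt_mem hA hK j))
  rw [gridObj, pairB_eq_pairA_sub, pairB_eq_pairA_sub]
  linarith [h2.1, h3.2]

variable {d : ℕ} {S : Type*} [Fintype S] [DecidableEq S] [MeasurableSpace S]
  [MeasurableSingletonClass S] {P : Measure (Obs d S)} [IsProbabilityMeasure P]
  {fStar fFair h : Feat d → S → ℝ} {lamStar : S → Fin M → ℝ}

omit [Fintype S] [DecidableEq S] [MeasurableSingletonClass S] in
lemma groupWeight_le_one (s : S) : groupWeight P s ≤ 1 := measureReal_le_one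

omit [Fintype S] [DecidableEq S] [MeasurableSpace S]
    [MeasurableSingletonClass S] in
lemma abs_mem_le_of_grid (hA : 0 ≤ A) (hK : 2 ≤ K) {g : RandPred d S}
    (hg : ∀ x s ξ, g x s ξ ∈ Set.range (gridPt A K)) (x : Feat d) (s : S) (ξ : ℝ) :
    |g x s ξ| ≤ A := by
  obtain ⟨k, hk⟩ := hg x s ξ
  rw [← hk]; exact gridPt_mem hA hK k

omit [DecidableEq S] in
/-- The excess penalized risk is at most the duality gap of the predictor. -/
lemma excess_le_gap [NeZero K] (hA : 0 ≤ A) (hK : 2 ≤ K)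
    (hs : ∀ s, 0 < groupWeight P s) (hY : ∀ᵐ w ∂P, |w.2.2| ≤ A)
    (hB : IsBayes P fStar) (hl : ∀ m, l m ∈ Set.Ioo (0 : ℝ) 1)
    (hf : fFair ∈ fairClass P A K z l)
    (hlam : IsMinOn (dualObj P fStar A K z l) Set.univ lamStar) (u : ℝ) {g : RandPred d S}
    (hg : MeasurablePred g) (hgK : ∀ x s ξ, g x s ξ ∈ Set.range (gridPt A K))
    (lam : S → Fin M → ℝ) :
    penRisk P u z l lamStar g - penRisk P u z l lamStar (detPred fFair)
      ≤ ∑ s, ∫ v, (groupWeight P s * (g v.1.1 s v.2 - fStar v.1.1 s) ^ 2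
          + pairB z l (lamStar s) (g v.1.1 s v.2)
          + maxObj A K z l (groupWeight P s) (fStar v.1.1 s) (lam s))
          ∂((groupLaw P s).prod (ditherLaw u)) := by
  have hgA := abs_mem_le_of_grid hA hK hgK
  have h1 := neg_dualObj_le_penRisk (z := z) hA hK hs hY hB hl u (g := detPred fFair)
    (hf.1.comp measurable_fst) (fun x s _ => hf.2.1 x s) lamStar
  have h2 := isMinOn_iff.1 hlam lam (Set.mem_univ _)
  rw [dualObj_eq hs (ditherLaw u) lam] at h2
  rw [penRisk_eq hs hY hB hl u hg hgA]
  have h3 : ∀ s, ∫ v, (groupWeight P s * (g v.1.1 s v.2 - fStar v.1.1 s) ^ 2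
          + pairB z l (lamStar s) (g v.1.1 s v.2)
          + maxObj A K z l (groupWeight P s) (fStar v.1.1 s) (lam s))
          ∂((groupLaw P s).prod (ditherLaw u))
      = ∫ v, (groupWeight P s * (g v.1.1 s v.2 - fStar v.1.1 s) ^ 2
          + pairB z l (lamStar s) (g v.1.1 s v.2)) ∂((groupLaw P s).prod (ditherLaw u))
        + ∫ v, maxObj A K z l (groupWeight P s) (fStar v.1.1 s) (lam s)
          ∂((groupLaw P s).prod (ditherLaw u)) := fun s =>
    integral_add (((integrable_sq_group hs hY hB _ hg hgA s).const_mul _).add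
      (integrable_pairB_group (z := z) hs hl _ hg _ s))
      (integrable_maxObj_group (z := z) hA hK hs hY hB hl _ _ s)
  rw [Finset.sum_congr rfl fun s _ => h3 s, Finset.sum_add_distrib]
  linarith

/-- A bound of the excess penalized risk that holds for every grid-valued predictor. -/
lemma excess_le_crude [NeZero K] (hA : 0 ≤ A) (hK : 2 ≤ K) (hM : 1 ≤ M)
    (hs : ∀ s, 0 < groupWeight P s) (hY : ∀ᵐ w ∂P, |w.2.2| ≤ A)
    (hB : IsBayes P fStar) (hl : ∀ m, l m ∈ Set.Ioo (0 : ℝ) 1) (hlm : StrictMono l)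
    (hzm : StrictMono z) (hf : fFair ∈ fairClass P A K z l)
    (hlam : IsMinOn (dualObj P fStar A K z l) Set.univ lamStar) (u : ℝ) {g : RandPred d S}
    (hg : MeasurablePred g) (hgK : ∀ x s ξ, g x s ξ ∈ Set.range (gridPt A K)) :
    penRisk P u z l lamStar g - penRisk P u z l lamStar (detPred fFair)
      ≤ Fintype.card S * (16 * A ^ 2 * M) := by
  have hgA := abs_mem_le_of_grid hA hK hgK
  refine (excess_le_gap hA hK hs hY hB hl hf hlam u hg hgK lamStar).trans ?_
  rw [← nsmul_eq_mul, ← Finset.card_univ]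
  refine Finset.sum_le_card_nsmul _ _ _ fun s _ => ?_
  have := isProbabilityMeasure_groupLaw (hs s)
  have hint := (((integrable_sq_group hs hY hB (ditherLaw u) hg hgA s).const_mul
    (groupWeight P s)).add (integrable_pairB_group (z := z) hs hl _ hg (lamStar s) s)).add
    (integrable_maxObj_group (z := z) hA hK hs hY hB hl (ditherLaw u) (lamStar s) s)
  refine (integral_mono_ae hint (integrable_const (16 * A ^ 2 * M)) ?_).trans (by simp)
  filter_upwards [hB.ae_group_abs_le hY (ditherLaw u) s] with v hv
  have hp1 := groupWeight_le_one (P := P) s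
  have hp0 := (hs s).le
  have hc : ∀ m, |lamStar s m| ≤ 4 * A ^ 2 := fun m =>
    (abs_lamStar_le hA hK hs hY hB hl hlm hzm hf hlam s m).trans
      (mul_le_of_le_one_right (by positivity) hp1)
  have h1 := (abs_le.1 (abs_pairB_le (z := z) hc hl (g v.1.1 s v.2))).2
  have h2 := (abs_le.1 (abs_maxObj_le (z := z) hA hK hl hp0 hv hc)).2
  have h3 : groupWeight P s * (g v.1.1 s v.2 - fStar v.1.1 s) ^ 2 ≤ 1 * (4 * A ^ 2) := by
    gcongr
    exact sq_sub_le_of_abs_le (hgA _ _ _) hv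
  have h4 : 4 * A ^ 2 * groupWeight P s ≤ 4 * A ^ 2 := mul_le_of_le_one_right (by positivity) hp1
  have h5 : (1 : ℝ) ≤ M := by exact_mod_cast hM
  have h6 : 0 ≤ A ^ 2 := sq_nonneg A
  simp only [Pi.add_apply]
  nlinarith

variable {N : ℕ} {D : Fin N → CalPt d S} {lamHat : S → Fin M → ℝ}

omit [DecidableEq S] in
/-- The error of the dithered base regressor. -/
lemma sum_groups_abs_sub_dithered_le (hs : ∀ s, 0 < groupWeight P s)
    (hY : ∀ᵐ w ∂P, |w.2.2| ≤ A) (hA : 0 ≤ A)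
    (hB : IsBayes P fStar) (hh : Measurable fun v : Feat d × S => h v.1 v.2)
    (hint : Integrable (fun w : Obs d S => h w.1 w.2.1 - fStar w.1 w.2.1) P) {u : ℝ}
    (hu : 0 ≤ u) :
    ∑ s, groupWeight P s * ∫ v, |fStar v.1.1 s - dithered A h v.1.1 s v.2|
        ∂((groupLaw P s).prod (ditherLaw u))
      ≤ ∫ w, |h w.1 w.2.1 - fStar w.1 w.2.1| ∂P + u := by
  have hi : Integrable (fun v : Obs d S × ℝ =>
      |fStar v.1.1 v.1.2.1 - dithered A h v.1.1 v.1.2.1 v.2|) (P.prod (ditherLaw u)) := by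
    refine Integrable.of_bound ((hB.measurable.comp measurable_fst).sub
      (measurable_pred (measurablePred_dithered hh))).abs.aestronglyMeasurable (2 * A) ?_
    filter_upwards [hB.ae_prod_abs_le hY (ditherLaw u)] with v hv
    rw [Real.norm_eq_abs, abs_abs]
    exact (abs_sub _ _).trans (by linarith [abs_dithered_le (h := h) hA v.1.1 v.1.2.1 v.2])
  rw [← integral_eq_sum_groups (ditherLaw u) hs
    (fun s v => |fStar v.1.1 s - dithered A h v.1.1 s v.2|) hi]
  have hi' : Integrable (fun v : Obs d S × ℝ => |h v.1.1 v.1.2.1 - fStar v.1.1 v.1.2.1|)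
      (P.prod (ditherLaw u)) := hint.abs.comp_fst (ditherLaw u)
  have hfst : ∫ w, |h w.1 w.2.1 - fStar w.1 w.2.1| ∂P
      = ∫ v, |h v.1.1 v.1.2.1 - fStar v.1.1 v.1.2.1| ∂(P.prod (ditherLaw u)) := by
    rw [integral_fun_fst (μ := P) (ν := ditherLaw u) fun w => |h w.1 w.2.1 - fStar w.1 w.2.1|]
    simp
  calc _ ≤ ∫ v, (|h v.1.1 v.1.2.1 - fStar v.1.1 v.1.2.1| + u) ∂(P.prod (ditherLaw u)) := by
        refine integral_mono_ae hi (hi'.add (integrable_const _)) ?_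
        filter_upwards [hB.ae_prod_abs_le hY (ditherLaw u),
          Measure.quasiMeasurePreserving_snd.ae (ae_ditherLaw_mem hu)] with v hv hξ
        exact abs_sub_dithered_le hv _ _ hξ
    _ = _ := by rw [integral_add hi' (integrable_const _), hfst]; simp

/-- The excess penalized risk of the post-processed predictor on the event where the calibration
counts are close to their means. -/
lemma excess_le_of_uniformlyClose [Nonempty S] [NeZero K] (hA : 0 ≤ A) (hK : 2 ≤ K) (hM : 1 ≤ M)
    (hN : 1 ≤ N) {πmin : ℝ} (hπ : 0 < πmin) (hs : ∀ s, πmin ≤ groupWeight P s)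
    (hY : ∀ᵐ w ∂P, |w.2.2| ≤ A)
    (hB : IsBayes P fStar) (hl : ∀ m, l m ∈ Set.Ioo (0 : ℝ) 1) (hlm : StrictMono l)
    (hzm : StrictMono z) (hf : fFair ∈ fairClass P A K z l)
    (hlam : IsMinOn (dualObj P fStar A K z l) Set.univ lamStar)
    (hh : Measurable fun v : Feat d × S => h v.1 v.2)
    (hint : Integrable (fun w : Obs d S => h w.1 w.2.1 - fStar w.1 w.2.1) P) {u : ℝ}
    (hu : 0 ≤ u) (hcont : ∀ s, Continuous (groupCDF P u (dithered A h) s)) {η : ℝ} (hη : 0 ≤ η)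
    (hD : UniformlyClose P u h A D η)
    (hlamHat : IsMinOn (empDualObj h A K z l D) Set.univ lamHat) {g : RandPred d S}
    (hg : IsPostProcessed h A K z D lamHat g) :
    penRisk P u z l lamStar g - penRisk P u z l lamStar (detPred fFair)
      ≤ 8 * A * (∫ w, |h w.1 w.2.1 - fStar w.1 w.2.1| ∂P + u)
        + 32 * Fintype.card S * A ^ 2 / πmin * M * η := by
  have hs' : ∀ s, 0 < groupWeight P s := fun s => hπ.trans_le (hs s)
  have hgK : ∀ x s ξ, g x s ξ ∈ Set.range (gridPt A K) := fun x s ξ => (hg.2 x s ξ).1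
  have hgA := abs_mem_le_of_grid hA hK hgK
  have hM' : (1 : ℝ) ≤ M := by exact_mod_cast hM
  have hπ1 : πmin ≤ 1 := (hs (Classical.arbitrary S)).trans (groupWeight_le_one _)
  -- When `η` is large the crude bound already has the right order. Otherwise no group is empty, so
  -- every `λ̂_s` is bounded and `π̂_s > 0`.
  rcases le_or_gt (πmin / 2) η with hcase | hcase
  · refine (excess_le_crude hA hK hM hs' hY hB hl hlm hzm hf hlam u hg.1 hgK).trans ?_
    have h0 : 0 ≤ ∫ w, |h w.1 w.2.1 - fStar w.1 w.2.1| ∂P :=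
      integral_nonneg fun _ => abs_nonneg _
    have h1 : 0 ≤ 8 * A * (∫ w, |h w.1 w.2.1 - fStar w.1 w.2.1| ∂P + u) := by positivity
    have h2 : (Fintype.card S : ℝ) * (16 * A ^ 2 * M)
        = 32 * Fintype.card S * A ^ 2 / πmin * M * (πmin / 2) := by field_simp; ring
    rw [h2]
    refine le_trans ?_ (le_add_of_nonneg_left h1)
    gcongr
  · have hNs : ∀ s, 0 < groupCount D s := by
      intro s
      by_contra hcon
      have h0 : groupCount D s = 0 := by omega
      have h1 := abs_empWeight_sub_le hA hN hs' hD s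
      rw [empWeight, h0, Nat.cast_zero, zero_div, zero_sub, abs_neg, abs_of_pos (hs' s)] at h1
      linarith [hs s]
    refine (excess_le_gap hA hK hs' hY hB hl hf hlam u hg.1 hgK lamHat).trans ?_
    have hgroup : ∀ s, ∫ v, (groupWeight P s * (g v.1.1 s v.2 - fStar v.1.1 s) ^ 2
          + pairB z l (lamStar s) (g v.1.1 s v.2)
          + maxObj A K z l (groupWeight P s) (fStar v.1.1 s) (lamHat s))
          ∂((groupLaw P s).prod (ditherLaw u))
        ≤ 32 * A ^ 2 / πmin * M * η + 8 * A * (groupWeight P s *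
          ∫ v, |fStar v.1.1 s - dithered A h v.1.1 s v.2|
            ∂((groupLaw P s).prod (ditherLaw u))) := by
      intro s
      have := isProbabilityMeasure_groupLaw (hs' s)
      have hi1 := ((((integrable_sq_group hs' hY hB (ditherLaw u) hg.1 hgA s).const_mul
        (groupWeight P s)).add (integrable_pairB_group (z := z) hs' hl _ hg.1 (lamStar s) s)).add
        (integrable_maxObj_group (z := z) hA hK hs' hY hB hl (ditherLaw u) (lamHat s) s))
      have hi2 := integrable_pairB_group (z := z) hs' hl (ditherLaw u) hg.1
        (lamStar s - lamHat s) s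
      have hi3 : Integrable (fun v : Obs d S × ℝ => |fStar v.1.1 s - dithered A h v.1.1 s v.2|)
          ((groupLaw P s).prod (ditherLaw u)) := by
        refine Integrable.of_bound ((hB.measurable_group s).sub
          (measurable_pred_group (measurablePred_dithered hh) s)).abs.aestronglyMeasurable
          (2 * A) ?_
        filter_upwards [hB.ae_group_abs_le hY (ditherLaw u) s] with v hv
        rw [Real.norm_eq_abs, abs_abs]
        exact (abs_sub _ _).trans (by linarith [abs_dithered_le (h := h) hA v.1.1 s v.2])
      have hle := integral_mono_ae hi1
        ((hi2.add (integrable_const (8 * A ^ 2 * η))).add (hi3.const_mul (8 * A * groupWeight P s)))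
        (by
          filter_upwards [hB.ae_group_abs_le hY (ditherLaw u) s] with v hv
          obtain ⟨h1, h2⟩ := hg.2 v.1.1 s v.2
          have h3 := maxObj_le_of_isMinOn (l := l) hA hK (hs' s).le hv
            (abs_dithered_le hA _ _ _) h1 h2
          have h4 := abs_empWeight_sub_le hA hN hs' hD s
          rw [abs_sub_comm] at h4
          have h5 : |groupWeight P s - empWeight D s| * (4 * A ^ 2) ≤ η * (4 * A ^ 2) := by gcongr
          simp only [Pi.add_apply]
          rw [pairB_sub]
          linarith)
      refine hle.trans ?_
      rw [integral_add' (hi2.add (integrable_const _)) (hi3.const_mul _),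
        integral_add' hi2 (integrable_const _), integral_const_mul (8 * A * groupWeight P s),
        integral_pairB hs' u hg.1]
      simp only [integral_const, probReal_univ, one_smul]
      -- Each multiplier is at most `4 A²`, and each constraint is violated by at most `2 η / πmin`.
      have hsum : ∑ m, (lamStar s - lamHat s) m * (groupCDF P u g s (z m) - l m)
          ≤ M * (8 * A ^ 2 * (2 * η / πmin)) := by
        calc _ ≤ ∑ _m : Fin M, 8 * A ^ 2 * (2 * η / πmin) := by
              refine Finset.sum_le_sum fun m _ => ?_
              refine (le_abs_self _).trans ?_
              rw [abs_mul]
              have h1 := abs_lamStar_le hA hK hs' hY hB hl hlm hzm hf hlam s m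
              have h2 := abs_lamHat_le hA hK hl hlm hzm
                (exists_gridPt_le_of_fairClass hf (hs' s) hl hlm hzm)
                (exists_lt_gridPt_of_fairClass hf (hs' s) hl hlm hzm) hlamHat (hNs s) m
              have h3 := groupWeight_mul_abs_unfairness_le hA hN hs' hl hD hcont hlamHat hg
                (hNs s) m
              have hA2 : 0 ≤ 4 * A ^ 2 := by positivity
              have h4 : |(lamStar s - lamHat s) m| ≤ 8 * A ^ 2 := by
                have h5 := mul_le_of_le_one_right hA2 (groupWeight_le_one (P := P) s)
                have h6 := mul_le_of_le_one_right hA2 (empWeight_mem D s).2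
                exact (abs_sub _ _).trans (by linarith)
              have h7 : |groupCDF P u g s (z m) - l m| ≤ 2 * η / πmin := by
                rw [le_div_iff₀ hπ, mul_comm]
                exact (mul_le_mul_of_nonneg_right (hs s) (abs_nonneg _)).trans h3
              gcongr
          _ = _ := by simp
      have h8 : 8 * A ^ 2 * η ≤ 16 * A ^ 2 / πmin * M * η := by
        have h9 : 8 * A ^ 2 ≤ 16 * A ^ 2 / πmin := by
          rw [le_div_iff₀ hπ]
          nlinarith [sq_nonneg A]
        have h10 : 16 * A ^ 2 / πmin * 1 ≤ 16 * A ^ 2 / πmin * M := by gcongr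
        have : 8 * A ^ 2 ≤ 16 * A ^ 2 / πmin * M := by linarith
        gcongr
      have h11 : M * (8 * A ^ 2 * (2 * η / πmin)) = 16 * A ^ 2 / πmin * M * η := by ring
      have h12 : 32 * A ^ 2 / πmin * M * η
          = 16 * A ^ 2 / πmin * M * η + 16 * A ^ 2 / πmin * M * η := by ring
      rw [h12, mul_assoc (8 * A)]
      linarith
    refine (Finset.sum_le_sum fun s _ => hgroup s).trans ?_
    rw [Finset.sum_add_distrib, Finset.sum_const, nsmul_eq_mul, Finset.card_univ,
      ← Finset.mul_sum]
    have h13 := mul_le_mul_of_nonneg_left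
      (sum_groups_abs_sub_dithered_le hs' hY hA hB hh hint hu) (by positivity : 0 ≤ 8 * A)
    have h14 : (Fintype.card S : ℝ) * (32 * A ^ 2 / πmin * M * η)
        = 32 * Fintype.card S * A ^ 2 / πmin * M * η := by ring
    linarith

end Excess

/-! ### Conditioning on the labeled sample, and the final constants -/

/-- Under independence the joint law is a product, so the constant kernel disintegrates it. -/
lemma condDistrib_ae_eq_const {Ω α β : Type*} [MeasurableSpace Ω] [MeasurableSpace α]
    [MeasurableSpace β] [StandardBorelSpace β] [Nonempty β] {μ : Measure Ω}
    [IsProbabilityMeasure μ] {X : Ω → α} {Y : Ω → β} {ν : Measure β} [IsProbabilityMeasure ν]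
    (hX : AEMeasurable X μ) (hY : HasLaw Y ν μ) (h : IndepFun X Y μ) :
    ∀ᵐ x ∂(μ.map X), condDistrib Y X μ x = ν := by
  have := condDistrib_ae_eq_of_measure_eq_compProd (μ := μ) X hY.aemeasurable
    (κ := Kernel.const α ν) (by
      rw [(indepFun_iff_map_prod_eq_prod_map_map hX hY.aemeasurable).1 h, hY.map_eq,
        Measure.compProd_const])
  filter_upwards [this] with x hx
  rw [hx, Kernel.const_apply]

lemma sqrt_add_le_add_sqrt {a b : ℝ} (ha : 0 ≤ a) (hb : 0 ≤ b) : √(a + b) ≤ √a + √b := by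
  refine Real.sqrt_le_iff.2 ⟨by positivity, ?_⟩
  nlinarith [Real.sq_sqrt ha, Real.sq_sqrt hb, Real.sqrt_nonneg a, Real.sqrt_nonneg b,
    mul_nonneg (Real.sqrt_nonneg a) (Real.sqrt_nonneg b)]

/-- The radius at which the deviation bound over the groups equals `δ`. -/
lemma deviation_radius {S : Type*} [Fintype S] [Nonempty S] {N : ℕ} (hN : 1 ≤ N) {δ : ℝ}
    (hδ : δ ∈ Set.Ioo (0 : ℝ) 1) :
    0 ≤ √(8 * Real.log (4 * Fintype.card S / δ) / N) ∧
    √(8 * Real.log (4 * Fintype.card S / δ) / N)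
      ≤ (√(8 * Real.log (4 * Fintype.card S)) + √8) *
        (√(1 / (N : ℝ)) + √(Real.log (1 / δ) / N)) ∧
    Fintype.card S *
      (4 * Real.exp (-(N * √(8 * Real.log (4 * Fintype.card S / δ) / N) ^ 2 / 8))) = δ := by
  have hN' : (0 : ℝ) < N := by exact_mod_cast hN
  have hS : (1 : ℝ) ≤ Fintype.card S := by exact_mod_cast Fintype.card_pos
  have hδ0 : 0 < δ := hδ.1
  have hlogS : 0 ≤ Real.log (4 * Fintype.card S) := Real.log_nonneg (by linarith)
  have hlogδ : 0 ≤ Real.log (1 / δ) := Real.log_nonneg (by rw [le_div_iff₀ hδ0]; linarith [hδ.2])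
  have hsplit : Real.log (4 * Fintype.card S / δ)
      = Real.log (4 * Fintype.card S) + Real.log (1 / δ) := by
    rw [← Real.log_mul (by positivity) (by positivity)]; ring_nf
  refine ⟨Real.sqrt_nonneg _, ?_, ?_⟩
  · rw [hsplit]
    have e : 8 * (Real.log (4 * Fintype.card S) + Real.log (1 / δ)) / N
        = 8 * Real.log (4 * Fintype.card S) * (1 / N) + 8 * (Real.log (1 / δ) / N) := by ring
    rw [e]
    refine (sqrt_add_le_add_sqrt (by positivity) (by positivity)).trans ?_
    rw [Real.sqrt_mul (by positivity), Real.sqrt_mul (by positivity) (Real.log (1 / δ) / N)]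
    have h1 := Real.sqrt_nonneg (8 * Real.log (4 * Fintype.card S))
    have h2 := Real.sqrt_nonneg 8
    have h3 := Real.sqrt_nonneg (1 / (N : ℝ))
    have h4 := Real.sqrt_nonneg (Real.log (1 / δ) / N)
    nlinarith [mul_nonneg h1 h4, mul_nonneg h2 h3]
  · have hlog : 0 ≤ Real.log (4 * Fintype.card S / δ) := by rw [hsplit]; positivity
    rw [Real.sq_sqrt (by positivity)]
    have e : -(N * (8 * Real.log (4 * Fintype.card S / δ) / N) / 8)
        = -Real.log (4 * Fintype.card S / δ) := by field_simp
    rw [e, Real.exp_neg, Real.exp_log (by positivity)]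
    field_simp

end
end FairReg

theorem mainTheorem6 {S : Type*} [Fintype S] [DecidableEq S] [Nonempty S]
    [MeasurableSpace S] [MeasurableSingletonClass S]
    (πmin : ℝ) (hπmin : 0 < πmin) (A : ℝ) (hA : 0 < A) :
    -- the two constants depend only on `S`, `πmin` and `A`
    ∃ C₁ C₂ : ℝ,
      ∀ (d : ℕ) (P : Measure (FairReg.Obs d S)) [IsProbabilityMeasure P]
        (K M n N : ℕ) (z l : Fin M → ℝ) (u : ℝ)
        (fStar fFair : FairReg.Feat d → S → ℝ) (lamStar : S → Fin M → ℝ)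
        (train : (Fin n → FairReg.Obs d S) → FairReg.Feat d → S → ℝ)
        (Ω : Type*) [MeasurableSpace Ω] (μ : Measure Ω) [IsProbabilityMeasure μ]
        (Dn : Ω → Fin n → FairReg.Obs d S) (DN : Ω → Fin N → FairReg.CalPt d S),
        (∀ᵐ w ∂P, |w.2.2| ≤ A) →
        (∀ s, πmin ≤ FairReg.groupWeight P s) →
        2 ≤ K → 1 ≤ M → 1 ≤ N → 0 ≤ u →
        StrictMono l → (∀ m, l m ∈ Set.Ioo (0 : ℝ) 1) →
        StrictMono z → (∀ m, z m ∈ Set.Icc (-A) A) →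
        -- regression function, dual-optimal multipliers, optimal fair discretized predictor
        FairReg.IsBayes P fStar →
        IsMinOn (FairReg.dualObj P fStar A K z l) Set.univ lamStar →
        FairReg.IsOptimalFair P A K z l fFair →
        -- the labeled sample and the (dithered) calibration sample are i.i.d. and independent
        HasLaw Dn (Measure.pi fun _ => P) μ →
        HasLaw DN (Measure.pi fun _ => FairReg.calLaw P u) μ →
        IndepFun Dn DN μ →
        -- the base regressor is a measurable function for each labeled sample
        (∀ D, Measurable fun v : FairReg.Feat d × S => train D v.1 v.2) →
        ∀ᵐ D ∂(μ.map Dn),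
            Integrable (fun w : FairReg.Obs d S => train D w.1 w.2.1 - fStar w.1 w.2.1) P →
            (∀ s, Continuous (FairReg.groupCDF P u (FairReg.dithered A (train D)) s)) →
            ∀ δ ∈ Set.Ioo (0 : ℝ) 1, condDistrib DN Dn μ D
              {D' | ¬ ∀ (lamHat : S → Fin M → ℝ) (g : FairReg.RandPred d S),
                IsMinOn (FairReg.empDualObj (train D) A K z l D') Set.univ lamHat →
                FairReg.IsPostProcessed (train D) A K z D' lamHat g →
                FairReg.penRisk P u z l lamStar g
                    - FairReg.penRisk P u z l lamStar (FairReg.detPred fFair)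
                  ≤ C₁ * ((∫ w, |train D w.1 w.2.1 - fStar w.1 w.2.1| ∂P) + √(1 / (N : ℝ)) + u)
                    + C₂ * M * (√(1 / (N : ℝ)) + (K : ℝ) ^ 2 / N + √(Real.log (1 / δ) / N))}
              ≤ ENNReal.ofReal δ := by
  refine ⟨8 * A, 32 * Fintype.card S * A ^ 2 / πmin * (√(8 * Real.log (4 * Fintype.card S)) + √8),
    ?_⟩
  intro d P _ K M n N z l u fStar fFair lamStar train Ω _ μ _ Dn DN hY hs hK hM hN hu hlm hl hzm _
    hB hlam hF hDn hDN hind htrain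
  have : NeZero K := ⟨by omega⟩
  have hs' : ∀ s, 0 < FairReg.groupWeight P s := fun s => hπmin.trans_le (hs s)
  filter_upwards [FairReg.condDistrib_ae_eq_const hDn.aemeasurable hDN hind]
    with D hD hint hcont δ hδ
  rw [hD]
  obtain ⟨hη, hηle, hηexp⟩ := FairReg.deviation_radius (S := S) hN hδ
  set η := √(8 * Real.log (4 * Fintype.card S / δ) / N) with hηdef
  -- The failure event lies in the event of bad calibration counts, which depends on neither the
  -- minimizer nor the predictor. This covers all choices of both at once, with no measurability of
  -- the failure event.
  refine (measure_mono ?_).trans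
    ((FairReg.measure_not_uniformlyClose_le (A := A) hs' (htrain D) u N hη).trans_eq
      (by rw [hηexp]))
  intro D' hD' hclose
  refine hD' fun lamHat g hlamHat hg => ?_
  refine (FairReg.excess_le_of_uniformlyClose hA.le hK hM hN hπmin hs hY hB hl hlm hzm hF.1 hlam
    (htrain D) hint hu hcont hη hclose hlamHat hg).trans ?_
  have h1 : 0 ≤ √(1 / (N : ℝ)) := Real.sqrt_nonneg _
  have h2 : 0 ≤ (K : ℝ) ^ 2 / N := by positivity
  set R := √(1 / (N : ℝ)) + √(Real.log (1 / δ) / N)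
  set c := √(8 * Real.log (4 * Fintype.card S)) + √8
  -- The `K² / N` term is pure slack: the deviation bound does not depend on the grid size. So is
  -- the `√(1 / N)` next to the regression error.
  have h3 : R ≤ √(1 / (N : ℝ)) + (K : ℝ) ^ 2 / N + √(Real.log (1 / δ) / N) := by
    simp only [R]; linarith
  refine add_le_add (mul_le_mul_of_nonneg_left (by linarith) (by positivity)) ?_
  calc 32 * Fintype.card S * A ^ 2 / πmin * M * η
      ≤ 32 * Fintype.card S * A ^ 2 / πmin * M *
        (c * (√(1 / (N : ℝ)) + (K : ℝ) ^ 2 / N + √(Real.log (1 / δ) / N))) := by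
        refine mul_le_mul_of_nonneg_left (hηle.trans ?_) (by positivity)
        exact mul_le_mul_of_nonneg_left h3 (by positivity)
    _ = _ := by ring
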